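/- Let $\mathscr G$ be an ample groupoid, i.e. a topological groupoid whose unit space $\mathscr G^{(0)}$ is locally compact Hausdorff with a basis of compact open sets and whose range map $r$ is a local homeomorphism onto $\mathscr G^{(0)}$; write $d$ for the source map. Let $\mathcal O$ be a $\mathscr G$-sheaf of unital rings, i.e. a local homeomorphism $p\colon E\to\mathscr G^{(0)}$ with unital ring structures on the stalks $\mathcal O_x=p^{-1}(x)$ such that addition, multiplication and the unit section are continuous, together with a continuous action of $\mathscr G$ on $E$ by ring isomorphisms $\alpha_\gamma\colon\mathcal O_{d(\gamma)}\to\mathcal O_{r(\gamma)}$. Let $R=\Gamma_c(\mathscr G,\mathcal O)$ be the convolution ring: the additive group generated by the maps $f\colon\mathscr G\to E$ with $f(\gamma)\in\mathcal O_{r(\gamma)}$ that are continuous on some compact open bisection $U$ and vanish off $U$, with product $(f*g)(\gamma)=\sum_{\beta\rho=\gamma}f(\beta)\alpha_\beta(g(\rho))$. For a unit $x$ let $\mathscr G_x^x$ be the isotropy group, $B_x=\mathcal O_x\rtimes\mathscr G_x^x$ the skew group ring, and $\mathcal L_x=\bigoplus_{d(\gamma)=x}\mathcal O_{r(\gamma)}$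 the $R$-$B_x$-bimodule with $$f\cdot a1_\gamma=\sum_{d(\beta)=r(\gamma)}f(\beta)\alpha_\beta(a)1_{\beta\gamma},\qquad a1_\gamma\cdot b\delta=a\alpha_\gamma(b)1_{\gamma\delta}.$$ For a left $B_x$-module $M$ put $\mathrm{Ind}_x(M)=\mathcal L_x\otimes_{B_x}M$. A simple $R$-module is a non-zero left $R$-module $S$ with $RS=S$ whose only submodules are $0$ and $S$; an ideal is (left) primitive if it is the annihilator of a simple left $R$-module. For a left $R$-module $S$ let $\mathrm{Sh}(S)$ be the associated $\mathscr G$-sheaf of $\mathcal O$-modules: its stalk at $x$ is $S_x=S/N_x$, where $N_x=\{m\in S:\chi_Vm=0$ for some compact open $V\subseteq\mathscr G^{(0)}$ with $x\in V\}$; its topology has as basis the sets $\{[m]_x: x\in V\}$ ($m\in S$, $V\subseteq\mathscr G^{(0)}$ compact open); the $\mathcal O_x$-action is $a[m]_x=[tm]_x$ for a compactly supported section $t$ of $\mathcal O$ over $\mathscr G^{(0)}$ with $t(x)=a$; and $\beta_\gamma([m]_{d(\gamma)})=[\chi_Um]_{r(\gamma)}$ for a compact open bisection $U\ni\gamma$.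 The stalk $S_x$ is a left $B_x$-module via $b\delta\cdot m=b\,\beta_\delta(m)$. **Theorem.** Let $I$ be a primitive ideal of $R$. Then there exist $x\in\mathscr G^{(0)}$ and a left $B_x$-module $M$ such that $I=\mathrm{Ann}(\mathrm{Ind}_x(M))$. Moreover, $M$ can be taken to be a stalk of the sheaf of a simple module: for every simple left $R$-module $S$ with $I=\mathrm{Ann}(S)$ there is a unit $x$ with $S_x\ne0$, and for every unit $x$ with $S_x\neq 0$ one has $I=\mathrm{Ann}(\mathrm{Ind}_x(S_x))$. -/

import Mathlib

open CategoryTheory TopologicalSpace Topology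
open scoped DirectSum TensorProduct Classical

universe u v w z


noncomputable section

namespace AmpleSheaf

/-! ### Ample groupoids -/

section Groupoids

/-- The arrow space `𝒢⁽¹⁾` of a groupoid: `γ : src ⟶ tgt` has `d(γ) = src` and `r(γ) = tgt`.
The product `βγ` of two arrows with `d(β) = r(γ)` is `γ ≫ β`. -/
@[ext] structure Arr (X : Type u) [Groupoid.{v} X] : Type (max u v) where
  src : X
  tgt : X
  hom : src ⟶ tgt

/-- Pairs `(γ, β)` of arrows with `r(γ) = d(β)`. -/
structure ComposablePair (X : Type u) [Groupoid.{v} X] : Type (max u v) where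
  src : X
  mid : X
  tgt : X
  fst : src ⟶ mid
  snd : mid ⟶ tgt

variable {X : Type u} [Groupoid.{v} X]

/-- The arrow `γ` as a point of the arrow space. -/
abbrev arr {x y : X} (γ : x ⟶ y) : Arr X := ⟨x, y, γ⟩

/-- The unit at `x`. -/
abbrev unit (x : X) : Arr X := arr (𝟙 x)

/-- Composable pairs carry the subspace topology of the product of two copies of the arrow space. -/
instance ComposablePair.instTopologicalSpace [TopologicalSpace (Arr X)] :
    TopologicalSpace (ComposablePair X) :=
  TopologicalSpace.induced (fun p => (arr p.fst, arr p.snd)) inferInstance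

end Groupoids

/-- An ample groupoid: a topological groupoid whose unit space `X` is locally compact Hausdorff with
a basis of compact open sets and whose range map is a local homeomorphism.
The unit space is presented as the space `X` of objects. -/
class AmpleGroupoid (X : Type u) [TopologicalSpace X] [Groupoid.{v} X] where
  [topArr : TopologicalSpace (Arr X)]
  continuous_src : Continuous (Arr.src : Arr X → X)
  continuous_tgt : Continuous (Arr.tgt : Arr X → X)
  continuous_unit : Continuous (unit : X → Arr X)
  continuous_inv : Continuous fun γ : Arr X => arr (Groupoid.inv γ.hom)
  continuous_comp : Continuous fun p : ComposablePair X => arr (p.fst ≫ p.snd)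
  t2Space : T2Space X
  locallyCompactSpace : LocallyCompactSpace X
  isLocalHomeomorph_tgt : IsLocalHomeomorph (Arr.tgt : Arr X → X)
  isTopologicalBasis : IsTopologicalBasis {U : Set X | IsOpen U ∧ IsCompact U}

attribute [reducible] AmpleGroupoid.topArr
attribute [instance] AmpleGroupoid.topArr AmpleGroupoid.t2Space

/-- Compact open bisections. (The range map embeds such a set into the Hausdorff unit space,
so it is automatically a Hausdorff subspace.) -/
structure IsCompactOpenBisection {X : Type u} [TopologicalSpace X] [Groupoid.{v} X]
    [AmpleGroupoid X] (U : Set (Arr X)) : Prop where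
  isCompact : IsCompact U
  isOpen : IsOpen U
  injOn_src : Set.InjOn Arr.src U
  injOn_tgt : Set.InjOn Arr.tgt U

/-! ### Sheaves of rings and of modules -/

section Total

variable {X : Type u}

/-- The disjoint union `E = ∐ₓ Aₓ` of a family of stalks; `pt` is the projection `p : E → X`. -/
@[ext] structure Total (A : X → Type w) : Type (max u w) where
  pt : X
  val : A pt

/-- The fibre product `E ×_X F`. -/
structure FiberProd (A : X → Type w) (B : X → Type z) : Type (max u w z) where
  pt : X
  fst : A pt
  snd : B pt

/-- The pullback `𝒢⁽¹⁾ ×_{d,p} E`. -/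
structure ActPair [Groupoid.{v} X] (A : X → Type w) : Type (max u v w) where
  arrow : Arr X
  val : A arrow.src

instance FiberProd.instTopologicalSpace (A : X → Type w) (B : X → Type z)
    [TopologicalSpace (Total A)] [TopologicalSpace (Total B)] :
    TopologicalSpace (FiberProd A B) :=
  TopologicalSpace.induced
    (fun p => ((⟨p.pt, p.fst⟩ : Total A), (⟨p.pt, p.snd⟩ : Total B))) inferInstance

instance ActPair.instTopologicalSpace [Groupoid.{v} X] (A : X → Type w)
    [TopologicalSpace (Arr X)] [TopologicalSpace (Total A)] :
    TopologicalSpace (ActPair A) :=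
  TopologicalSpace.induced
    (fun p => (p.arrow, (⟨p.arrow.src, p.val⟩ : Total A))) inferInstance

end Total

/-- A `𝒢`-sheaf of unital rings `𝒪 = (E, p, α)`; `E` is the disjoint union of the stalks, `p` the
projection, and `act γ` is `α_γ`. -/
structure SheafOfRings (X : Type u) [TopologicalSpace X] [Groupoid.{v} X] [AmpleGroupoid X] :
    Type (max u v (w + 1)) where
  stalk : X → Type w
  [ring : ∀ x, Ring (stalk x)]
  [top : TopologicalSpace (Total stalk)]
  isLocalHomeomorph_pt : IsLocalHomeomorph (Total.pt : Total stalk → X)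
  act : ∀ {x y : X}, (x ⟶ y) → stalk x →+* stalk y
  act_id : ∀ (x : X) (a : stalk x), act (𝟙 x) a = a
  act_comp : ∀ {x y z : X} (γ : x ⟶ y) (β : y ⟶ z) (a : stalk x),
    act β (act γ a) = act (γ ≫ β) a
  continuous_act : Continuous fun p : ActPair stalk =>
    (⟨p.arrow.tgt, act p.arrow.hom p.val⟩ : Total stalk)
  continuous_add : Continuous fun p : FiberProd stalk stalk =>
    (⟨p.pt, p.fst + p.snd⟩ : Total stalk)
  continuous_mul : Continuous fun p : FiberProd stalk stalk =>
    (⟨p.pt, p.fst * p.snd⟩ : Total stalk)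
  continuous_one : Continuous fun x : X => (⟨x, 1⟩ : Total stalk)

attribute [instance] SheafOfRings.ring SheafOfRings.top

variable {X : Type u} [TopologicalSpace X] [Groupoid.{v} X] [AmpleGroupoid X]

/-- A `𝒢`-sheaf of `𝒪`-modules `ℳ = (F, q, β)`; `act γ` is `β_γ`. -/
structure SheafOfModules (O : SheafOfRings.{u, v, w} X) : Type (max u v w (z + 1)) where
  stalk : X → Type z
  [addCommGroup : ∀ x, AddCommGroup (stalk x)]
  [module : ∀ x, Module (O.stalk x) (stalk x)]
  [top : TopologicalSpace (Total stalk)]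
  isLocalHomeomorph_pt : IsLocalHomeomorph (Total.pt : Total stalk → X)
  act : ∀ {x y : X}, (x ⟶ y) → stalk x →+ stalk y
  act_id : ∀ (x : X) (m : stalk x), act (𝟙 x) m = m
  act_comp : ∀ {x y z : X} (γ : x ⟶ y) (β : y ⟶ z) (m : stalk x),
    act β (act γ m) = act (γ ≫ β) m
  act_smul : ∀ {x y : X} (γ : x ⟶ y) (a : O.stalk x) (m : stalk x),
    act γ (a • m) = O.act γ a • act γ m
  continuous_act : Continuous fun p : ActPair stalk =>
    (⟨p.arrow.tgt, act p.arrow.hom p.val⟩ : Total stalk)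
  continuous_add : Continuous fun p : FiberProd stalk stalk =>
    (⟨p.pt, p.fst + p.snd⟩ : Total stalk)
  continuous_smul : Continuous fun p : FiberProd O.stalk stalk =>
    (⟨p.pt, p.fst • p.snd⟩ : Total stalk)

attribute [instance] SheafOfModules.addCommGroup SheafOfModules.module SheafOfModules.top

variable (O : SheafOfRings.{u, v, w} X)

/-! ### The convolution algebra -/

/-- `A(𝒢, 𝒪)`: all maps `f` with `f(γ) ∈ 𝒪_{r(γ)}`. -/
abbrev ArrowMap : Type (max u v w) := ∀ γ : Arr X, O.stalk γ.tgt

variable {O}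

/-- `f` is continuous on `U` and vanishes outside of `U`. -/
def SupportedOn (f : ArrowMap O) (U : Set (Arr X)) : Prop :=
  ContinuousOn (fun γ => (⟨γ.tgt, f γ⟩ : Total O.stalk)) U ∧ ∀ γ, γ ∉ U → f γ = 0

variable (O)

/-- `Γ_c(𝒢, 𝒪)` as a subgroup of `A(𝒢, 𝒪)`. -/
def gammaSubgroup : AddSubgroup (ArrowMap O) :=
  AddSubgroup.closure {f | ∃ U : Set (Arr X), IsCompactOpenBisection U ∧ SupportedOn f U}

/-- `Γ_c(𝒢, 𝒪)`. -/
def Gamma : Type (max u v w) := gammaSubgroup O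

instance : AddCommGroup (Gamma O) := inferInstanceAs (AddCommGroup (gammaSubgroup O))

variable {O}

instance : CoeFun (Gamma O) (fun _ => ArrowMap O) := ⟨fun f => f.1⟩

/-- Convolution, `(f * g)(γ) = ∑_{βρ = γ} f(β) α_β(g(ρ))`; the factorizations `γ = βρ` are indexed by
the arrows `β` with range `r(γ)`, the other factor being `ρ = β⁻¹γ`. -/
def conv (f g : ArrowMap O) : ArrowMap O := fun γ =>
  ∑ᶠ b : (Σ y : X, (y ⟶ γ.tgt)), f (arr b.2) * O.act b.2 (g (arr (γ.hom ≫ Groupoid.inv b.2)))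


/-! #### Finiteness on the fibres of `d` and `r` -/

section Finiteness

theorem exists_section_of_isOpenMap {Y : Type*} {Z : Type*} [TopologicalSpace Y]
    [TopologicalSpace Z] {f : Y → Z} (hf : IsOpenMap f) {U : Set Y} (hU : IsOpen U)
    (hi : Set.InjOn f U) (hY : Nonempty Y) :
    ∃ σ : Z → Y, (∀ y ∈ U, σ (f y) = y) ∧ ContinuousOn σ (f '' U) := by
  refine ⟨Function.invFunOn f U, fun y hy => hi.leftInvOn_invFunOn hy, ?_⟩
  have hl : ∀ y ∈ U, Function.invFunOn f U (f y) = y := fun y hy => hi.leftInvOn_invFunOn hy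
  rintro _ ⟨y, hy, rfl⟩
  rw [ContinuousWithinAt, hl y hy, (hf U hU).nhdsWithin_eq ⟨y, hy, rfl⟩]
  intro W hW
  have : f '' (W ∩ U) ∈ 𝓝 (f y) := hf.image_mem_nhds (Filter.inter_mem hW (hU.mem_nhds hy))
  rw [Filter.mem_map]
  filter_upwards [this]
  rintro _ ⟨y', ⟨h1, h2⟩, rfl⟩
  simpa [hl y' h2] using h1

theorem isOpenMap_tgt : IsOpenMap (Arr.tgt : Arr X → X) :=
  AmpleGroupoid.isLocalHomeomorph_tgt.isOpenMap

theorem isOpenMap_src : IsOpenMap (Arr.src : Arr X → X) := by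
  intro U hU
  have h : Arr.src '' U = Arr.tgt '' ((fun γ : Arr X => arr (Groupoid.inv γ.hom)) ⁻¹' U) := by
    ext x
    constructor
    · rintro ⟨γ, hγ, rfl⟩
      exact ⟨arr (Groupoid.inv γ.hom), by simpa using hγ, rfl⟩
    · rintro ⟨γ, hγ, rfl⟩
      exact ⟨_, hγ, rfl⟩
  rw [h]
  exact isOpenMap_tgt _ (hU.preimage AmpleGroupoid.continuous_inv)

theorem finite_src {f : ArrowMap O} (hf : f ∈ gammaSubgroup O) (x : X) :
    {γ : Arr X | γ.src = x ∧ f γ ≠ 0}.Finite := by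
  induction hf using AddSubgroup.closure_induction with
  | mem f hf =>
    obtain ⟨U, hU, -, h0⟩ := hf
    refine Set.Subsingleton.finite ?_
    rintro γ ⟨h1, h2⟩ δ ⟨h3, h4⟩
    exact hU.injOn_src (by_contra fun h => h2 (h0 γ h)) (by_contra fun h => h4 (h0 δ h))
      (h1.trans h3.symm)
  | zero => simp
  | add f g _ _ h1 h2 =>
    refine (h1.union h2).subset ?_
    rintro γ ⟨hx, h⟩
    by_contra hc
    simp only [Set.mem_union, Set.mem_ofPred_eq, hx, true_and, not_or, not_not] at hc
    exact h (by simp [hc.1, hc.2])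
  | neg f _ h => simpa using h

theorem finite_tgt {f : ArrowMap O} (hf : f ∈ gammaSubgroup O) (x : X) :
    {γ : Arr X | γ.tgt = x ∧ f γ ≠ 0}.Finite := by
  induction hf using AddSubgroup.closure_induction with
  | mem f hf =>
    obtain ⟨U, hU, -, h0⟩ := hf
    refine Set.Subsingleton.finite ?_
    rintro γ ⟨h1, h2⟩ δ ⟨h3, h4⟩
    exact hU.injOn_tgt (by_contra fun h => h2 (h0 γ h)) (by_contra fun h => h4 (h0 δ h))
      (h1.trans h3.symm)
  | zero => simp
  | add f g _ _ h1 h2 =>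
    refine (h1.union h2).subset ?_
    rintro γ ⟨hx, h⟩
    by_contra hc
    simp only [Set.mem_union, Set.mem_ofPred_eq, hx, true_and, not_or, not_not] at hc
    exact h (by simp [hc.1, hc.2])
  | neg f _ h => simpa using h

theorem finite_out {f : ArrowMap O} (hf : f ∈ gammaSubgroup O) (x : X) :
    {b : (Σ y : X, (x ⟶ y)) | f (arr b.2) ≠ 0}.Finite := by
  refine Set.Finite.of_injOn (f := fun b : (Σ y : X, (x ⟶ y)) => arr b.2) (t := {γ : Arr X | γ.src = x ∧ f γ ≠ 0})
    (fun b hb => ⟨rfl, hb⟩) ?_ (finite_src hf x)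
  rintro ⟨y, γ⟩ _ ⟨z, δ⟩ _ h
  cases h
  rfl

theorem finite_into {f : ArrowMap O} (hf : f ∈ gammaSubgroup O) (x : X) :
    {b : (Σ y : X, (y ⟶ x)) | f (arr b.2) ≠ 0}.Finite := by
  refine Set.Finite.of_injOn (f := fun b : (Σ y : X, (y ⟶ x)) => arr b.2) (t := {γ : Arr X | γ.tgt = x ∧ f γ ≠ 0})
    (fun b hb => ⟨rfl, hb⟩) ?_ (finite_tgt hf x)
  rintro ⟨y, γ⟩ _ ⟨z, δ⟩ _ h
  cases h
  rfl

theorem finite_conv {f : ArrowMap O} (hf : f ∈ gammaSubgroup O) (g : ArrowMap O) (γ : Arr X) :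
    (Function.support fun b : (Σ y : X, (y ⟶ γ.tgt)) =>
      (show O.stalk γ.tgt from f (arr b.2)) * O.act b.2 (g (arr (γ.hom ≫ Groupoid.inv b.2)))).Finite := by
  refine (finite_into hf γ.tgt).subset fun b hb h => hb ?_
  simp only [h, zero_mul]

theorem conv_add_left {f f' : ArrowMap O} (hf : f ∈ gammaSubgroup O) (hf' : f' ∈ gammaSubgroup O)
    (g : ArrowMap O) : conv (f + f') g = conv f g + conv f' g := by
  funext γ
  simp only [conv, Pi.add_apply, add_mul]
  exact finsum_add_distrib (finite_conv hf g γ) (finite_conv hf' g γ)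

theorem conv_add_right {f : ArrowMap O} (hf : f ∈ gammaSubgroup O)
    (g g' : ArrowMap O) : conv f (g + g') = conv f g + conv f g' := by
  funext γ
  simp only [conv, Pi.add_apply, map_add, mul_add]
  exact finsum_add_distrib (finite_conv hf g γ) (finite_conv hf g' γ)

theorem conv_zero_left (g : ArrowMap O) : conv 0 g = 0 := by
  funext γ
  simp [conv]

theorem conv_zero_right (f : ArrowMap O) : conv f 0 = 0 := by
  funext γ
  simp [conv]

theorem conv_neg_left (f g : ArrowMap O) : conv (-f) g = - conv f g := by
  funext γ
  simp [conv, finsum_neg_distrib]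

theorem conv_neg_right (f g : ArrowMap O) : conv f (-g) = - conv f g := by
  funext γ
  simp [conv, finsum_neg_distrib]

end Finiteness

/-! #### The convolution of functions supported on compact open bisections -/

section Convolution

theorem conv_apply_of_injOn_tgt {f : ArrowMap O} {U : Set (Arr X)} (hU : Set.InjOn Arr.tgt U)
    (hf : ∀ γ, γ ∉ U → f γ = 0) (g : ArrowMap O) {x y z : X} (γ : x ⟶ y) (β : y ⟶ z)
    (hβ : arr β ∈ U) :
    conv f g (arr (γ ≫ β)) = f (arr β) * O.act β (g (arr γ)) := by
  unfold conv
  rw [finsum_eq_single _ (⟨y, β⟩ : Σ y : X, (y ⟶ z))]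
  · have key : ∀ h : x ⟶ y, h = γ → O.act β (g (arr h)) = O.act β (g (arr γ)) := by
      rintro _ rfl
      rfl
    exact congrArg (f (arr β) * ·) (key _ (by simp))
  · rintro ⟨y', β'⟩ h
    by_cases h' : arr β' ∈ U
    · have := hU h' hβ rfl
      cases this
      exact absurd rfl h
    · simp only [hf _ h', zero_mul]

/-- The product `UV` of two sets of arrows. -/
def mulSet (U V : Set (Arr X)) : Set (Arr X) :=
  {δ | ∃ p : ComposablePair X, arr p.snd ∈ U ∧ arr p.fst ∈ V ∧ arr (p.fst ≫ p.snd) = δ}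

theorem conv_eq_zero {f g : ArrowMap O} {U V : Set (Arr X)}
    (hf : ∀ γ, γ ∉ U → f γ = 0) (hg : ∀ γ, γ ∉ V → g γ = 0) (δ : Arr X)
    (hδ : δ ∉ mulSet U V) : conv f g δ = 0 := by
  unfold conv
  rw [finsum_eq_zero_of_forall_eq_zero]
  rintro ⟨y, β⟩
  by_cases h1 : arr β ∈ U
  · by_cases h2 : arr (δ.hom ≫ Groupoid.inv β) ∈ V
    · exact absurd ⟨⟨δ.src, y, δ.tgt, δ.hom ≫ Groupoid.inv β, β⟩, h1, h2, by simp⟩ hδ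
    · simp only [hg _ h2, map_zero, mul_zero]
  · simp only [hf _ h1, zero_mul]

theorem continuous_pairFst : Continuous fun p : ComposablePair X => arr p.fst :=
  continuous_fst.comp
    (continuous_induced_dom (f := fun p : ComposablePair X => (arr p.fst, arr p.snd)))

theorem continuous_pairSnd : Continuous fun p : ComposablePair X => arr p.snd :=
  continuous_snd.comp
    (continuous_induced_dom (f := fun p : ComposablePair X => (arr p.fst, arr p.snd)))

theorem ComposablePair.ext' {p q : ComposablePair X} (h1 : arr p.fst = arr q.fst)
    (h2 : arr p.snd = arr q.snd) : p = q := by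
  cases p; cases q
  cases h1
  cases h2
  rfl

theorem isClosedEmbedding_pair :
    IsClosedEmbedding fun p : ComposablePair X => (arr p.fst, arr p.snd) := by
  refine ⟨⟨⟨rfl⟩, fun p q h => ComposablePair.ext' (congrArg Prod.fst h) (congrArg Prod.snd h)⟩, ?_⟩
  have : (Set.range fun p : ComposablePair X => (arr p.fst, arr p.snd)) =
      {q : Arr X × Arr X | q.1.tgt = q.2.src} := by
    ext ⟨⟨a, b, γ⟩, ⟨c, d, β⟩⟩
    constructor
    · rintro ⟨p, hp⟩
      cases hp
      rfl
    · intro h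
      obtain rfl : b = c := h
      exact ⟨⟨a, b, d, γ, β⟩, rfl⟩
  rw [this]
  exact isClosed_eq (AmpleGroupoid.continuous_tgt.comp continuous_fst)
    (AmpleGroupoid.continuous_src.comp continuous_snd)

theorem isOpen_mulSet {U V : Set (Arr X)} (hU : IsCompactOpenBisection U) (hV : IsOpen V) :
    IsOpen (mulSet U V) := by
  rw [isOpen_iff_mem_nhds]
  rintro _ ⟨p₀, h1, h2, rfl⟩
  obtain ⟨σ, hσ, hc⟩ := exists_section_of_isOpenMap isOpenMap_tgt hU.isOpen hU.injOn_tgt ⟨arr p₀.fst⟩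
  set A : Set (Arr X) := Arr.tgt ⁻¹' (Arr.tgt '' U) with hA
  have hAo : IsOpen A := (isOpenMap_tgt _ hU.isOpen).preimage AmpleGroupoid.continuous_tgt
  have hσA : ∀ δ ∈ A, σ δ.tgt ∈ U ∧ (σ δ.tgt).tgt = δ.tgt := by
    rintro δ ⟨u, hu, h⟩
    rw [← h, hσ u hu]
    exact ⟨hu, rfl⟩
  let κ : A → ComposablePair X := fun δ =>
    ⟨δ.1.src, δ.1.tgt, (σ δ.1.tgt).src, δ.1.hom,
      eqToHom (hσA δ.1 δ.2).2.symm ≫ Groupoid.inv (σ δ.1.tgt).hom⟩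
  have hκ2 : ∀ δ : A, arr (κ δ).snd = arr (Groupoid.inv (σ δ.1.tgt).hom) := by
    intro δ
    have h := (hσA δ.1 δ.2).2
    have key : ∀ (b : X) (τ : Arr X) (h : τ.tgt = b),
        arr (eqToHom h.symm ≫ Groupoid.inv τ.hom) = arr (Groupoid.inv τ.hom) := by
      rintro b τ rfl
      simp
    exact key _ _ h
  have hκ : Continuous κ := by
    rw [continuous_induced_rng]
    refine Continuous.prodMk continuous_subtype_val ?_
    have : (fun δ : A => arr (κ δ).snd) = fun δ : A => arr (Groupoid.inv (σ δ.1.tgt).hom) :=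
      funext hκ2
    show Continuous (fun δ : A => arr (κ δ).snd)
    rw [this]
    refine AmpleGroupoid.continuous_inv.comp ?_
    have h3 : ContinuousOn (fun δ : Arr X => σ δ.tgt) A :=
      hc.comp AmpleGroupoid.continuous_tgt.continuousOn fun δ hδ => hδ
    exact h3.domRestrict
  have hopen : IsOpen (Subtype.val '' {δ : A | arr ((κ δ).fst ≫ (κ δ).snd) ∈ V}) :=
    hAo.isOpenMap_subtype_val _ (hV.preimage (AmpleGroupoid.continuous_comp.comp hκ))
  have hval : ∀ δ : A, ∃ (x y z : X) (γ : x ⟶ y) (β : z ⟶ y), arr γ = δ.1 ∧ arr β = σ δ.1.tgt ∧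
      arr ((κ δ).fst ≫ (κ δ).snd) = arr (γ ≫ Groupoid.inv β) := by
    rintro ⟨δ, hδ⟩
    have h := (hσA δ hδ).2
    have key : ∀ (τ : Arr X) (h : τ.tgt = δ.tgt), ∃ (x y z : X) (γ : x ⟶ y) (β : z ⟶ y),
        arr γ = δ ∧ arr β = τ ∧
        arr (δ.hom ≫ eqToHom h.symm ≫ Groupoid.inv τ.hom) = arr (γ ≫ Groupoid.inv β) := by
      rintro ⟨a, b, τ⟩ h
      obtain rfl : b = δ.tgt := h
      exact ⟨_, _, _, δ.hom, τ, rfl, rfl, by simp⟩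
    exact key _ h
  refine Filter.mem_of_superset (hopen.mem_nhds ?_) ?_
  · refine ⟨⟨arr (p₀.fst ≫ p₀.snd), ⟨arr p₀.snd, h1, rfl⟩⟩, ?_, rfl⟩
    obtain ⟨x, y, z, γ, β, e1, e2, e3⟩ := hval ⟨arr (p₀.fst ≫ p₀.snd), ⟨arr p₀.snd, h1, rfl⟩⟩
    rw [Set.mem_ofPred_eq, e3]
    have e4 : arr β = arr p₀.snd := e2.trans (hσ _ h1)
    cases e4
    cases e1
    simpa using h2
  · rintro _ ⟨δ, hδ, rfl⟩
    obtain ⟨x, y, z, γ, β, e1, e2, e3⟩ := hval δ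
    rw [Set.mem_ofPred_eq, e3] at hδ
    refine ⟨⟨x, z, y, γ ≫ Groupoid.inv β, β⟩, ?_, hδ, ?_⟩
    · show arr β ∈ U
      rw [e2]
      exact (hσA δ.1 δ.2).1
    · rw [← e1]
      simp

theorem isCompactOpenBisection_mulSet {U V : Set (Arr X)} (hU : IsCompactOpenBisection U)
    (hV : IsCompactOpenBisection V) : IsCompactOpenBisection (mulSet U V) where
  isOpen := isOpen_mulSet hU hV.isOpen
  isCompact := by
    have h : mulSet U V = (fun p : ComposablePair X => arr (p.fst ≫ p.snd)) ''
        ((fun p : ComposablePair X => (arr p.fst, arr p.snd)) ⁻¹' (V ×ˢ U)) := by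
      ext δ
      constructor
      · rintro ⟨p, h1, h2, h3⟩
        exact ⟨p, ⟨h2, h1⟩, h3⟩
      · rintro ⟨p, ⟨h2, h1⟩, h3⟩
        exact ⟨p, h1, h2, h3⟩
    rw [h]
    exact (isClosedEmbedding_pair.isCompact_preimage (hV.isCompact.prod hU.isCompact)).image
      AmpleGroupoid.continuous_comp
  injOn_src := by
    rintro _ ⟨p, h1, h2, rfl⟩ _ ⟨q, h3, h4, rfl⟩ h
    have e1 := hV.injOn_src h2 h4 h
    have e2 := hU.injOn_src h1 h3 (congrArg Arr.tgt e1 :)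
    rw [ComposablePair.ext' e1 e2]
  injOn_tgt := by
    rintro _ ⟨p, h1, h2, rfl⟩ _ ⟨q, h3, h4, rfl⟩ h
    have e2 := hU.injOn_tgt h1 h3 h
    have e1 := hV.injOn_tgt h2 h4 (congrArg Arr.src e2 :)
    rw [ComposablePair.ext' e1 e2]

theorem supportedOn_conv {f g : ArrowMap O} {U V : Set (Arr X)} (hU : IsCompactOpenBisection U)
    (hV : IsCompactOpenBisection V) (hf : SupportedOn f U) (hg : SupportedOn g V) :
    SupportedOn (conv f g) (mulSet U V) := by
  refine ⟨?_, conv_eq_zero hf.2 hg.2⟩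
  rcases isEmpty_or_nonempty (Arr X) with hE | hne
  · intro γ
    exact hE.elim γ
  obtain ⟨σ, hσ, hσc⟩ := exists_section_of_isOpenMap isOpenMap_tgt hU.isOpen hU.injOn_tgt hne
  obtain ⟨τ, hτ, hτc⟩ := exists_section_of_isOpenMap isOpenMap_src hV.isOpen hV.injOn_src hne
  have hex : ∀ δ : mulSet U V, ∃ p : ComposablePair X,
      arr p.snd ∈ U ∧ arr p.fst ∈ V ∧ arr (p.fst ≫ p.snd) = δ.1 := fun δ => δ.2
  choose P hP1 hP2 hP3 using hex
  have hPσ : ∀ δ, arr (P δ).snd = σ δ.1.tgt := by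
    intro δ
    rw [← hσ _ (hP1 δ)]
    exact congrArg σ (congrArg Arr.tgt (hP3 δ) :)
  have hPτ : ∀ δ, arr (P δ).fst = τ δ.1.src := by
    intro δ
    rw [← hτ _ (hP2 δ)]
    exact congrArg τ (congrArg Arr.src (hP3 δ) :)
  have hs : Continuous fun δ : mulSet U V => arr (P δ).snd := by
    rw [funext hPσ]
    have h3 : ContinuousOn (fun δ : Arr X => σ δ.tgt) (mulSet U V) := by
      refine hσc.comp AmpleGroupoid.continuous_tgt.continuousOn ?_
      rintro _ ⟨p, h1, h2, rfl⟩
      exact ⟨_, h1, rfl⟩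
    exact h3.domRestrict
  have ht : Continuous fun δ : mulSet U V => arr (P δ).fst := by
    rw [funext hPτ]
    have h3 : ContinuousOn (fun δ : Arr X => τ δ.src) (mulSet U V) := by
      refine hτc.comp AmpleGroupoid.continuous_src.continuousOn ?_
      rintro _ ⟨p, h1, h2, rfl⟩
      exact ⟨_, h2, rfl⟩
    exact h3.domRestrict
  have hval : ∀ δ : mulSet U V, (⟨δ.1.tgt, conv f g δ.1⟩ : Total O.stalk) =
      ⟨(P δ).tgt, f (arr (P δ).snd) * O.act (P δ).snd (g (arr (P δ).fst))⟩ := by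
    intro δ
    rw [← conv_apply_of_injOn_tgt hU.injOn_tgt hf.2 g (P δ).fst (P δ).snd (hP1 δ)]
    exact congrArg (fun γ : Arr X => (⟨γ.tgt, conv f g γ⟩ : Total O.stalk)) (hP3 δ).symm
  rw [continuousOn_iff_continuous_domRestrict]
  have : (mulSet U V).domRestrict (fun γ => (⟨γ.tgt, conv f g γ⟩ : Total O.stalk)) =
      fun δ : mulSet U V =>
      ⟨(P δ).tgt, f (arr (P δ).snd) * O.act (P δ).snd (g (arr (P δ).fst))⟩ := funext hval
  rw [this]
  have hF : Continuous fun δ : mulSet U V =>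
      (⟨(P δ).tgt, f (arr (P δ).snd)⟩ : Total O.stalk) :=
    hf.1.comp_continuous hs hP1
  have hG : Continuous fun δ : mulSet U V =>
      (⟨(P δ).mid, g (arr (P δ).fst)⟩ : Total O.stalk) :=
    hg.1.comp_continuous ht hP2
  have hA : Continuous fun δ : mulSet U V =>
      (⟨arr (P δ).snd, g (arr (P δ).fst)⟩ : ActPair O.stalk) := by
    rw [continuous_induced_rng]
    exact hs.prodMk hG
  have hB : Continuous fun δ : mulSet U V =>
      (⟨(P δ).tgt, f (arr (P δ).snd), O.act (P δ).snd (g (arr (P δ).fst))⟩ :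
        FiberProd O.stalk O.stalk) := by
    rw [continuous_induced_rng]
    exact hF.prodMk (O.continuous_act.comp hA)
  exact O.continuous_mul.comp hB

theorem conv_mem {f g : ArrowMap O} (hf : f ∈ gammaSubgroup O) (hg : g ∈ gammaSubgroup O) :
    conv f g ∈ gammaSubgroup O := by
  induction hf using AddSubgroup.closure_induction with
  | mem f hf =>
    have hf' : f ∈ gammaSubgroup O := AddSubgroup.subset_closure hf
    obtain ⟨U, hU, hfU⟩ := hf
    induction hg using AddSubgroup.closure_induction with
    | mem g hg =>
      obtain ⟨V, hV, hgV⟩ := hg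
      exact AddSubgroup.subset_closure
        ⟨_, isCompactOpenBisection_mulSet hU hV, supportedOn_conv hU hV hfU hgV⟩
    | zero => rw [conv_zero_right]; exact zero_mem _
    | add g g' _ _ h1 h2 => rw [conv_add_right hf']; exact add_mem h1 h2
    | neg g _ h => rw [conv_neg_right]; exact neg_mem h
  | zero => rw [conv_zero_left]; exact zero_mem _
  | add f f' h h' h1 h2 => rw [conv_add_left h h']; exact add_mem h1 h2
  | neg f _ h => rw [conv_neg_left]; exact neg_mem h

end Convolution

/-! #### The module `ℒ_x` and the two actions on it -/

variable (O)

/-- `ℒ_x = ⨁_{d(γ) = x} 𝒪_{r(γ)}`. -/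
abbrev LMod (x : X) : Type (max u v w) := ⨁ γ : (Σ y : X, (x ⟶ y)), O.stalk γ.1

/-- The element `a1_γ` of `ℒ_x`. -/
def lsingle {x y : X} (γ : x ⟶ y) : O.stalk y →+ LMod O x :=
  DirectSum.of (fun γ : (Σ y : X, (x ⟶ y)) => O.stalk γ.1) ⟨y, γ⟩

variable {O}

theorem lmod_hom_ext {x : X} {A : Type*} [AddCommMonoid A] {φ ψ : LMod O x →+ A}
    (h : ∀ (y : X) (γ : x ⟶ y) (a : O.stalk y), φ (lsingle O γ a) = ψ (lsingle O γ a)) : φ = ψ := by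
  refine DirectSum.addHom_ext ?_
  rintro ⟨y, γ⟩ a
  exact h y γ a

/-- The map `ℒ_y → ℒ_x`, `b1_β ↦ b1_β · aγ = b α_β(a) 1_{βγ}`, for `γ : x → y` and `a ∈ 𝒪_y`.
For `y = x` this is the right action of `aγ ∈ B_x`. -/
def rmul {x y : X} (γ : x ⟶ y) (a : O.stalk y) : LMod O y →+ LMod O x :=
  DirectSum.toAddMonoid fun β : (Σ z : X, (y ⟶ z)) =>
    (lsingle O (γ ≫ β.2)).comp (AddMonoidHom.mulRight (O.act β.2 a))

@[simp] theorem rmul_lsingle {x y z : X} (γ : x ⟶ y) (a : O.stalk y) (β : y ⟶ z) (b : O.stalk z) :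
    rmul γ a (lsingle O β b) = lsingle O (γ ≫ β) (b * O.act β a) := by
  simp [rmul, lsingle]

theorem rmul_add {x y : X} (γ : x ⟶ y) (a b : O.stalk y) :
    rmul γ (a + b) = rmul γ a + rmul γ b := by
  refine lmod_hom_ext fun z β c => ?_
  simp [mul_add]

theorem rmul_zero {x y : X} (γ : x ⟶ y) : rmul γ (0 : O.stalk y) = 0 := by
  refine lmod_hom_ext fun z β c => ?_
  simp

theorem lsingle_congr {x y : X} {γ δ : x ⟶ y} (h : γ = δ) (a : O.stalk y) :
    lsingle O γ a = lsingle O δ a := by rw [h]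

theorem rmul_rmul {x y z : X} (δ : x ⟶ y) (b : O.stalk y) (γ : y ⟶ z) (a : O.stalk z)
    (ξ : LMod O z) : rmul δ b (rmul γ a ξ) = rmul (δ ≫ γ) (a * O.act γ b) ξ := by
  suffices h : (rmul δ b).comp (rmul γ a) = rmul (δ ≫ γ) (a * O.act γ b) from
    DFunLike.congr_fun h ξ
  refine lmod_hom_ext fun w β c => ?_
  simp [O.act_comp, mul_assoc]

theorem rmul_id {x : X} (ξ : LMod O x) : rmul (𝟙 x) 1 ξ = ξ := by
  suffices h : rmul (𝟙 x) (1 : O.stalk x) = AddMonoidHom.id _ from DFunLike.congr_fun h ξ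
  refine lmod_hom_ext fun w β c => ?_
  simp

/-- The finitely supported restriction of `f` to `d⁻¹(x)`, `∑_{d(β) = x} f(β) 1_β ∈ ℒ_x`. -/
def restrictFiber (f : Gamma O) (x : X) : LMod O x :=
  DFinsupp.mk (finite_out f.2 x).toFinset fun β => f (arr β.1.2)

theorem restrictFiber_apply (f : Gamma O) (x : X) (β : (Σ y : X, (x ⟶ y))) :
    restrictFiber f x β = f (arr β.2) := by
  unfold restrictFiber
  rw [DFinsupp.mk_apply]
  split_ifs with h
  · rfl
  · simp only [Set.Finite.mem_toFinset, Set.mem_ofPred_eq, not_not] at h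
    exact h.symm

theorem restrictFiber_add (f g : Gamma O) (x : X) :
    restrictFiber (f + g) x = restrictFiber f x + restrictFiber g x := by
  refine DFinsupp.ext fun β => ?_
  rw [DFinsupp.add_apply, restrictFiber_apply, restrictFiber_apply, restrictFiber_apply]
  rfl

theorem restrictFiber_injective {f g : Gamma O} (h : ∀ x, restrictFiber f x = restrictFiber g x) :
    f = g := by
  refine Subtype.ext (funext fun γ => ?_)
  have := DFunLike.congr_fun (h γ.src) ⟨γ.tgt, γ.hom⟩
  rwa [restrictFiber_apply, restrictFiber_apply] at this

/-- The left action of `f` on `ℒ_x`, `f · a1_γ = ∑_{d(β) = r(γ)} f(β) α_β(a) 1_{βγ}`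
(see `lmul_lsingle_eq_finsum`). -/
def lmul (x : X) (f : Gamma O) : LMod O x →+ LMod O x :=
  DirectSum.toAddMonoid fun γ : (Σ y : X, (x ⟶ y)) =>
    { toFun := fun a => rmul γ.2 a (restrictFiber f γ.1)
      map_zero' := by simp [rmul_zero]
      map_add' := fun a b => by simp [rmul_add] }

theorem lmul_lsingle (f : Gamma O) {x y : X} (γ : x ⟶ y) (a : O.stalk y) :
    lmul x f (lsingle O γ a) = rmul γ a (restrictFiber f y) := by
  simp [lmul, lsingle]

theorem restrictFiber_eq_finsum (f : Gamma O) (x : X) :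
    restrictFiber f x = ∑ᶠ β : (Σ y : X, (x ⟶ y)), lsingle O β.2 (f (arr β.2)) := by
  rw [finsum_eq_sum_of_support_subset (s := (restrictFiber f x).support)]
  · conv_lhs => rw [← DirectSum.sum_support_of (restrictFiber f x)]
    refine Finset.sum_congr rfl fun β _ => ?_
    rw [restrictFiber_apply]
    rfl
  · intro β hβ
    rw [Finset.mem_coe, DFinsupp.mem_support_iff, restrictFiber_apply]
    intro h
    exact hβ (by simp only [h, map_zero])

theorem lmul_lsingle_eq_finsum (f : Gamma O) {x y : X} (γ : x ⟶ y) (a : O.stalk y) :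
    lmul x f (lsingle O γ a) =
      ∑ᶠ β : (Σ z : X, (y ⟶ z)), lsingle O (γ ≫ β.2) (f (arr β.2) * O.act β.2 a) := by
  rw [lmul_lsingle, restrictFiber_eq_finsum, AddMonoidHom.map_finsum]
  · simp
  · refine (finite_out f.2 y).subset fun β hβ h => hβ ?_
    simp only [h, map_zero]

theorem lsingle_apply_self {x y : X} (γ : x ⟶ y) (a : O.stalk y) :
    lsingle O γ a ⟨y, γ⟩ = a :=
  DirectSum.of_eq_same _ _

theorem lsingle_apply_ne {x y z : X} (γ : x ⟶ y) (a : O.stalk y) (δ : x ⟶ z)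
    (h : (⟨y, γ⟩ : Σ y : X, (x ⟶ y)) ≠ ⟨z, δ⟩) : lsingle O γ a ⟨z, δ⟩ = 0 :=
  DirectSum.of_eq_of_ne _ _ _ h.symm

theorem rmul_apply {x y z : X} (γ : x ⟶ y) (a : O.stalk y) (ζ : LMod O y) (β : y ⟶ z) :
    rmul γ a ζ ⟨z, γ ≫ β⟩ = ζ ⟨z, β⟩ * O.act β a := by
  induction ζ using DirectSum.induction_on with
  | zero => simp
  | of i c =>
    obtain ⟨w, δ⟩ := i
    change rmul γ a (lsingle O δ c) _ = lsingle O δ c _ * _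
    rw [rmul_lsingle]
    by_cases h : (⟨w, δ⟩ : Σ y' : X, (y ⟶ y')) = ⟨z, β⟩
    · cases h
      rw [lsingle_apply_self, lsingle_apply_self]
    · rw [lsingle_apply_ne _ _ _ h, zero_mul, lsingle_apply_ne]
      intro h'
      apply h
      obtain rfl : w = z := congrArg Sigma.fst h'
      have h2 : γ ≫ δ = γ ≫ β := by simpa using h'
      rw [(cancel_epi γ).1 h2]
  | add ζ ζ' h h' => 
    rw [map_add, DirectSum.add_apply, DirectSum.add_apply, h, h', add_mul]

theorem finite_lmul {f : ArrowMap O} (hf : f ∈ gammaSubgroup O) {z : X}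
    (φ : ∀ b : (Σ y : X, (y ⟶ z)), O.stalk b.1) :
    (Function.support fun b : (Σ y : X, (y ⟶ z)) =>
      (show O.stalk z from f (arr b.2)) * O.act b.2 (φ b)).Finite := by
  refine (finite_into hf z).subset fun b hb h => hb ?_
  simp only [h, zero_mul]

theorem lmul_apply (f : Gamma O) {x z : X} (ξ : LMod O x) (δ : x ⟶ z) :
    lmul x f ξ ⟨z, δ⟩ = ∑ᶠ b : (Σ y : X, (y ⟶ z)),
      (show O.stalk z from f (arr b.2)) * O.act b.2 (ξ ⟨b.1, δ ≫ Groupoid.inv b.2⟩) := by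
  induction ξ using DirectSum.induction_on with
  | zero => simp
  | of i a =>
    obtain ⟨y, γ⟩ := i
    change lmul x f (lsingle O γ a) _ = _
    rw [lmul_lsingle]
    obtain ⟨β, rfl⟩ : ∃ β : y ⟶ z, δ = γ ≫ β := ⟨Groupoid.inv γ ≫ δ, by simp⟩
    rw [rmul_apply, restrictFiber_apply]
    rw [finsum_eq_single _ (⟨y, β⟩ : Σ y : X, (y ⟶ z))]
    · have key : ∀ h : x ⟶ y, h = γ → lsingle O γ a ⟨y, h⟩ = a := by
        rintro _ rfl
        exact lsingle_apply_self _ _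
      exact congrArg (fun c => (show O.stalk z from f (arr β)) * O.act β c) (key ((γ ≫ β) ≫ Groupoid.inv β) (by simp)).symm
    · rintro ⟨y', β'⟩ h
      have : lsingle O γ a ⟨y', (γ ≫ β) ≫ Groupoid.inv β'⟩ = 0 := by
        refine lsingle_apply_ne _ _ _ fun h' => h ?_
        obtain rfl : y = y' := congrArg Sigma.fst h'
        have h2 : γ = (γ ≫ β) ≫ Groupoid.inv β' := by simpa using h'
        have h3 : γ ≫ β' = γ ≫ β := by
          conv_lhs => rw [h2]
          simp
        rw [(cancel_epi γ).1 h3]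
      exact (congrArg (fun c => (show O.stalk z from f (arr β')) * O.act β' c) this).trans
        (by simp)
  | add ξ ξ' h h' =>
    rw [map_add, DirectSum.add_apply, h, h',
      ← finsum_add_distrib (finite_lmul f.2 _) (finite_lmul f.2 _)]
    simp [mul_add]

theorem lmul_rmul (f : Gamma O) {x y : X} (γ : x ⟶ y) (a : O.stalk y) (ξ : LMod O y) :
    lmul x f (rmul γ a ξ) = rmul γ a (lmul y f ξ) := by
  suffices h : (lmul x f).comp (rmul γ a) = (rmul γ a).comp (lmul y f) from DFunLike.congr_fun h ξ
  refine lmod_hom_ext fun z β b => ?_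
  simp [lmul_lsingle, rmul_rmul]

theorem lmul_add (x : X) (f g : Gamma O) : lmul x (f + g) = lmul x f + lmul x g := by
  refine lmod_hom_ext fun z β b => ?_
  simp [lmul_lsingle, restrictFiber_add]

instance : Mul (Gamma O) := ⟨fun f g => ⟨conv f g, conv_mem f.2 g.2⟩⟩

theorem restrictFiber_mul (f g : Gamma O) (x : X) :
    restrictFiber (f * g) x = lmul x f (restrictFiber g x) := by
  refine DFinsupp.ext ?_
  rintro ⟨z, δ⟩
  rw [restrictFiber_apply, lmul_apply]
  simp only [restrictFiber_apply]
  rfl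

theorem lmul_mul (x : X) (f g : Gamma O) (ξ : LMod O x) :
    lmul x (f * g) ξ = lmul x f (lmul x g ξ) := by
  suffices h : lmul x (f * g) = (lmul x f).comp (lmul x g) from DFunLike.congr_fun h ξ
  refine lmod_hom_ext fun z β b => ?_
  simp [lmul_lsingle, restrictFiber_mul, lmul_rmul]

/-- `Γ_c(𝒢, 𝒪)` is a ring (in general without unit) under convolution. -/
instance : NonUnitalRing (Gamma O) :=
  { (inferInstance : AddCommGroup (Gamma O)), (inferInstance : Mul (Gamma O)) with
    left_distrib := fun f g h => Subtype.ext (conv_add_right f.2 g.1 h.1)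
    right_distrib := fun f g h => Subtype.ext (conv_add_left f.2 g.2 h.1)
    zero_mul := fun f => Subtype.ext (conv_zero_left f.1)
    mul_zero := fun f => Subtype.ext (conv_zero_right f.1)
    mul_assoc := fun f g h => restrictFiber_injective fun x => by
      rw [restrictFiber_mul, restrictFiber_mul, restrictFiber_mul, lmul_mul] }

/-! ### Isotropy skew group rings and induced modules -/

/-- The isotropy group `𝒢ₓˣ` acts on `𝒪_x` through `α`. -/
instance isotropyAction (x : X) : MulSemiringAction (End x) (O.stalk x) where
  smul δ a := O.act δ a
  one_smul a := O.act_id x a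
  mul_smul β γ a := (O.act_comp γ β a).symm
  smul_zero δ := map_zero (O.act δ)
  smul_add δ := map_add (O.act δ)
  smul_one δ := map_one (O.act δ)
  smul_mul δ := map_mul (O.act δ)

variable (O)

/-- The isotropy skew group ring `B_x = 𝒪_x ⋊ 𝒢ₓˣ`; the element `bδ` is
`SkewMonoidAlgebra.single δ b`. -/
abbrev IsotropyRing (x : X) : Type (max v w) := SkewMonoidAlgebra (O.stalk x) (End x)

/-- The right action of `𝒪_x` on `ℒ_x`, `a1_γ · b = a α_γ(b) 1_γ`. -/
def rmulScalar (x : X) : O.stalk x →+* (AddMonoid.End (LMod O x))ᵐᵒᵖ where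
  toFun b := MulOpposite.op (rmul (𝟙 x) b)
  map_one' := by
    refine congrArg MulOpposite.op (AddMonoidHom.ext fun ξ => ?_)
    exact rmul_id ξ
  map_mul' a b := by
    refine congrArg MulOpposite.op (AddMonoidHom.ext fun ξ => ?_)
    show _ = rmul (𝟙 x) b (rmul (𝟙 x) a ξ)
    rw [rmul_rmul, O.act_id, Category.comp_id]
  map_zero' := congrArg MulOpposite.op (rmul_zero _)
  map_add' a b := congrArg MulOpposite.op (rmul_add _ a b)

/-- The right action of `𝒢ₓˣ` on `ℒ_x`, `a1_γ · δ = a 1_{γδ}`. -/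
def rmulIsotropy (x : X) : End x →* (AddMonoid.End (LMod O x))ᵐᵒᵖ where
  toFun δ := MulOpposite.op (rmul (End.asHom δ) 1)
  map_one' := by
    refine congrArg MulOpposite.op (AddMonoidHom.ext fun ξ => ?_)
    exact rmul_id ξ
  map_mul' β γ := by
    refine congrArg MulOpposite.op (AddMonoidHom.ext fun ξ => ?_)
    show rmul (End.asHom γ ≫ End.asHom β) 1 ξ = rmul (End.asHom γ) 1 (rmul (End.asHom β) 1 ξ)
    rw [rmul_rmul, map_one, mul_one]

/-- The right action of `B_x` on `ℒ_x` as a ring homomorphism to the opposite of the endomorphism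
ring of `ℒ_x`; `bδ` acts by first `b`, then `δ`. -/
def rmulHom (x : X) : IsotropyRing O x →+* (AddMonoid.End (LMod O x))ᵐᵒᵖ :=
  SkewMonoidAlgebra.liftNCRingHom (rmulScalar O x) (rmulIsotropy O x) (by
    intro b δ
    refine congrArg MulOpposite.op (AddMonoidHom.ext fun ξ => ?_)
    show rmul (End.asHom δ) 1 (rmul (𝟙 x) (O.act (End.asHom δ) b) ξ) =
      rmul (𝟙 x) b (rmul (End.asHom δ) 1 ξ)
    rw [rmul_rmul, rmul_rmul, map_one, mul_one, one_mul, Category.comp_id, Category.id_comp])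

/-- The right `B_x`-module structure on `ℒ_x`, `a1_γ · bδ = a α_γ(b) 1_{γδ}`. -/
instance lmodModule (x : X) : Module (IsotropyRing O x)ᵐᵒᵖ (LMod O x) where
  smul b ξ := (rmulHom O x b.unop).unop ξ
  one_smul ξ := by
    show (rmulHom O x 1).unop ξ = ξ
    rw [map_one]
    rfl
  mul_smul b c ξ := by
    show (rmulHom O x (c.unop * b.unop)).unop ξ = _
    rw [map_mul]
    rfl
  smul_zero b := map_zero _
  smul_add b := map_add _
  add_smul b c ξ := by
    show (rmulHom O x (b.unop + c.unop)).unop ξ = _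
    rw [map_add]
    rfl
  zero_smul ξ := by
    show (rmulHom O x 0).unop ξ = 0
    rw [map_zero]
    rfl

theorem op_single_smul {x : X} (δ : End x) (b : O.stalk x) (ξ : LMod O x) :
    MulOpposite.op (SkewMonoidAlgebra.single δ b : IsotropyRing O x) • ξ =
      rmul (End.asHom δ) b ξ := by
  have h : rmulHom O x (SkewMonoidAlgebra.single δ b) = rmulScalar O x b * rmulIsotropy O x δ :=
    SkewMonoidAlgebra.liftNC_single _ _ _ _
  show (rmulHom O x (SkewMonoidAlgebra.single δ b)).unop ξ = _
  rw [h]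
  show rmul (End.asHom δ) 1 (rmul (𝟙 x) b ξ) = _
  rw [rmul_rmul, map_one, mul_one, Category.comp_id]

theorem op_single_smul_lsingle {x y : X} (γ : x ⟶ y) (a : O.stalk y) (δ : End x) (b : O.stalk x) :
    MulOpposite.op (SkewMonoidAlgebra.single δ b : IsotropyRing O x) • lsingle O γ a =
      lsingle O (End.asHom δ ≫ γ) (a * O.act γ b) := by
  rw [op_single_smul, rmul_lsingle]

theorem lmul_op_smul {x : X} (f : Gamma O) (b : IsotropyRing O x) (ξ : LMod O x) :
    lmul x f (MulOpposite.op b • ξ) = MulOpposite.op b • lmul x f ξ := by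
  induction b using SkewMonoidAlgebra.induction_on with
  | zero => simp
  | single δ b => rw [op_single_smul, op_single_smul, lmul_rmul]
  | add b c hb hc => rw [MulOpposite.op_add, add_smul, add_smul, map_add, hb, hc]

/-- The subgroup of the tensor product of abelian groups generated by the elements
`(ξ · b) ⊗ m - ξ ⊗ (b · m)`. -/
def balancedSubgroup (B : Type*) (L : Type*) (M : Type*) [Ring B] [AddCommGroup L] [Module Bᵐᵒᵖ L]
    [AddCommGroup M] [Module B M] : AddSubgroup (L ⊗[ℤ] M) :=
  AddSubgroup.closure {t | ∃ (ξ : L) (b : B) (m : M),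
    t = (MulOpposite.op b • ξ) ⊗ₜ[ℤ] m - ξ ⊗ₜ[ℤ] (b • m)}

/-- The tensor product `L ⊗_B M` of a right module and a left module over a ring. -/
abbrev BalancedTensor (B : Type*) (L : Type*) (M : Type*) [Ring B] [AddCommGroup L] [Module Bᵐᵒᵖ L]
    [AddCommGroup M] [Module B M] :=
  (L ⊗[ℤ] M) ⧸ balancedSubgroup B L M

/-- `Ind_x(M) = ℒ_x ⊗_{B_x} M`. -/
abbrev IndModule (x : X) (M : Type z) [AddCommGroup M] [Module (IsotropyRing O x) M] :
    Type (max u v w z) :=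
  BalancedTensor (IsotropyRing O x) (LMod O x) M

/-- The left action of `f` on `Ind_x(M)`, `f · (ξ ⊗ m) = (f · ξ) ⊗ m`. -/
def indAction (x : X) (M : Type z) [AddCommGroup M] [Module (IsotropyRing O x) M] (f : Gamma O) :
    AddMonoid.End (IndModule O x M) :=
  QuotientAddGroup.map _ _ ((lmul x f).toIntLinearMap.rTensor M).toAddMonoidHom (by
    refine (AddSubgroup.closure_le _).2 ?_
    rintro _ ⟨ξ, b, m, rfl⟩
    refine AddSubgroup.subset_closure ⟨lmul x f ξ, b, m, ?_⟩
    simp [lmul_op_smul])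

theorem indAction_mk_tmul (x : X) (M : Type z) [AddCommGroup M] [Module (IsotropyRing O x) M]
    (f : Gamma O) (ξ : LMod O x) (m : M) :
    indAction O x M f (QuotientAddGroup.mk (ξ ⊗ₜ[ℤ] m)) =
      QuotientAddGroup.mk (lmul x f ξ ⊗ₜ[ℤ] m) := rfl

theorem indModule_hom_ext (x : X) (M : Type z) [AddCommGroup M] [Module (IsotropyRing O x) M]
    {φ ψ : AddMonoid.End (IndModule O x M)}
    (h : ∀ (ξ : LMod O x) (m : M), φ (QuotientAddGroup.mk (ξ ⊗ₜ[ℤ] m)) =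
      ψ (QuotientAddGroup.mk (ξ ⊗ₜ[ℤ] m))) : φ = ψ := by
  refine AddMonoidHom.ext fun t => ?_
  obtain ⟨t, rfl⟩ := QuotientAddGroup.mk_surjective t
  induction t using TensorProduct.induction_on with
  | zero => exact (map_zero φ).trans (map_zero ψ).symm
  | tmul ξ m => exact h ξ m
  | add s t hs ht =>
    exact (φ.map_add _ _).trans ((congrArg₂ (· + ·) hs ht).trans (ψ.map_add _ _).symm)

/-- The induced left `Γ_c(𝒢, 𝒪)`-module `Ind_x(M)`, given by the ring homomorphism from
`Γ_c(𝒢, 𝒪)` to the endomorphism ring of the abelian group `ℒ_x ⊗_{B_x} M`. -/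
def ind (x : X) (M : Type z) [AddCommGroup M] [Module (IsotropyRing O x) M] :
    Gamma O →ₙ+* AddMonoid.End (IndModule O x M) where
  toFun := indAction O x M
  map_mul' f g := indModule_hom_ext O x M fun ξ m => by
    rw [AddMonoid.End.coe_mul, Function.comp_apply, indAction_mk_tmul, indAction_mk_tmul, indAction_mk_tmul, lmul_mul]
  map_zero' := indModule_hom_ext O x M fun ξ m => by
    have h : lmul x (0 : Gamma O) = 0 := by simpa using lmul_add x (0 : Gamma O) 0
    rw [indAction_mk_tmul, h, AddMonoidHom.zero_apply, TensorProduct.zero_tmul]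
    rfl
  map_add' f g := indModule_hom_ext O x M fun ξ m => by
    show _ = indAction O x M f _ + indAction O x M g _
    rw [indAction_mk_tmul, indAction_mk_tmul, indAction_mk_tmul, lmul_add,
      AddMonoidHom.add_apply, TensorProduct.add_tmul]
    rfl

/-! ### Left modules over `Γ_c(𝒢, 𝒪)`

A left module over a ring `R` without unit is an abelian group `S` with a ring homomorphism `ρ` from
`R` to the endomorphism ring of `S`. -/

section NonUnitalModules

variable {R : Type*} [NonUnitalRing R] {S : Type*} [AddCommGroup S]

/-- The annihilator ideal of the left `R`-module `S` with action `ρ`. -/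
def annihilator (ρ : R →ₙ+* AddMonoid.End S) : TwoSidedIdeal R := TwoSidedIdeal.ker ρ

/-- The `R`-module `S` is simple: it is unitary (`RS = S`), non-zero, and has no submodules apart
from `0` and `S`. -/
structure IsSimpleRep (ρ : R →ₙ+* AddMonoid.End S) : Prop where
  nontrivial : Nontrivial S
  unitary : AddSubgroup.closure {s : S | ∃ (r : R) (m : S), s = ρ r m} = ⊤
  eq_bot_or_eq_top : ∀ N : AddSubgroup S, (∀ (r : R), ∀ m ∈ N, ρ r m ∈ N) → N = ⊥ ∨ N = ⊤

/-- A (left) primitive ideal: the annihilator of a simple left module. -/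
def IsPrimitiveIdeal (I : TwoSidedIdeal R) : Prop :=
  ∃ (S : Type z) (_ : AddCommGroup S) (ρ : R →ₙ+* AddMonoid.End S),
    IsSimpleRep ρ ∧ I = annihilator ρ

end NonUnitalModules

/-! ### Characteristic functions and germs -/

section Germs

variable {O}

theorem eventuallyEq_of_isLocalHomeomorph {E Y Z : Type*} [TopologicalSpace E] [TopologicalSpace Y]
    [TopologicalSpace Z] {p : E → Z} (hp : IsLocalHomeomorph p) {f g : Y → E} {y : Y}
    (hf : ContinuousAt f y) (hg : ContinuousAt g y) (h : f y = g y)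
    (hfg : ∀ᶠ t in 𝓝 y, p (f t) = p (g t)) : ∀ᶠ t in 𝓝 y, f t = g t := by
  obtain ⟨e, he, rfl⟩ := hp (f y)
  have h1 := hf.eventually (e.open_source.mem_nhds he)
  have h2 := hg.eventually (e.open_source.mem_nhds (h ▸ he))
  filter_upwards [h1, h2, hfg] with t h1 h2 h3
  exact e.injOn h1 h2 h3

theorem exists_compactOpens {V : Set X} (hV : IsOpen V) {x : X} (hx : x ∈ V) :
    ∃ K : CompactOpens X, x ∈ K ∧ (K : Set X) ⊆ V := by
  obtain ⟨K, ⟨h1, h2⟩, h3, h4⟩ :=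
    (AmpleGroupoid.isTopologicalBasis (X := X)).exists_subset_of_mem_open hx hV
  exact ⟨⟨⟨K, h2⟩, h1⟩, h3, h4⟩

theorem exists_injOn_tgt (γ : Arr X) : ∃ A : Set (Arr X), IsOpen A ∧ γ ∈ A ∧ Set.InjOn Arr.tgt A := by
  obtain ⟨e, he, h⟩ := AmpleGroupoid.isLocalHomeomorph_tgt γ
  exact ⟨e.source, e.open_source, he, h ▸ e.injOn⟩

theorem exists_injOn_src (γ : Arr X) : ∃ A : Set (Arr X), IsOpen A ∧ γ ∈ A ∧ Set.InjOn Arr.src A := by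
  obtain ⟨A, h1, h2, h3⟩ := exists_injOn_tgt (arr (Groupoid.inv γ.hom))
  refine ⟨_, h1.preimage AmpleGroupoid.continuous_inv, h2, ?_⟩
  intro δ hδ ε hε h
  have h4 := h3 hδ hε h
  have h5 := congrArg (fun γ : Arr X => arr (Groupoid.inv γ.hom)) h4
  have key : ∀ δ : Arr X, arr (Groupoid.inv (Groupoid.inv δ.hom)) = δ := fun δ => by
    rw [Groupoid.inv_eq_inv, Groupoid.inv_eq_inv, IsIso.inv_inv]
  exact (key δ).symm.trans (h5.trans (key ε))

/-- Compact open bisections form a basis. -/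
theorem exists_bisection {G : Set (Arr X)} (hG : IsOpen G) {γ : Arr X} (hγ : γ ∈ G) :
    ∃ W : Set (Arr X), IsCompactOpenBisection W ∧ γ ∈ W ∧ W ⊆ G := by
  obtain ⟨A, hA, hγA, hiA⟩ := exists_injOn_tgt γ
  obtain ⟨B, hB, hγB, hiB⟩ := exists_injOn_src γ
  set C := A ∩ B ∩ G with hC
  have hCo : IsOpen C := (hA.inter hB).inter hG
  have hiC : Set.InjOn Arr.tgt C := hiA.mono fun δ h => h.1.1
  obtain ⟨σ, hσ, hσc⟩ := exists_section_of_isOpenMap isOpenMap_tgt hCo hiC ⟨γ⟩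
  obtain ⟨K, hK, hKC⟩ := exists_compactOpens (isOpenMap_tgt _ hCo) ⟨γ, ⟨⟨hγA, hγB⟩, hγ⟩, rfl⟩
  have hW : C ∩ Arr.tgt ⁻¹' K = σ '' K := by
    ext δ
    constructor
    · rintro ⟨h1, h2⟩
      exact ⟨_, h2, hσ δ h1⟩
    · rintro ⟨x, hx, rfl⟩
      obtain ⟨δ, hδ, rfl⟩ := hKC hx
      rw [hσ δ hδ]
      exact ⟨hδ, hx⟩
  refine ⟨C ∩ Arr.tgt ⁻¹' K, ⟨?_, ?_, ?_, ?_⟩, ⟨⟨⟨hγA, hγB⟩, hγ⟩, hK⟩, fun δ h => h.1.2⟩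
  · rw [hW]
    exact K.isCompact.image_of_continuousOn (hσc.mono hKC)
  · exact hCo.inter (K.isOpen.preimage AmpleGroupoid.continuous_tgt)
  · exact hiB.mono fun δ h => h.1.1.2
  · exact hiC.mono fun δ h => h.1

theorem isOpenMap_unit : IsOpenMap (unit : X → Arr X) := by
  intro V hV
  rw [isOpen_iff_mem_nhds]
  rintro _ ⟨x, hx, rfl⟩
  obtain ⟨A, hA, hxA, hi⟩ := exists_injOn_tgt (unit x)
  have hc : Continuous fun γ : Arr X => unit γ.tgt :=
    AmpleGroupoid.continuous_unit.comp AmpleGroupoid.continuous_tgt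
  filter_upwards [hA.mem_nhds hxA, (hA.preimage hc).mem_nhds hxA,
    (hV.preimage AmpleGroupoid.continuous_tgt).mem_nhds hx] with γ h1 h2 h3
  exact ⟨γ.tgt, h3, hi h2 h1 rfl⟩

theorem isCompactOpenBisection_unit (V : CompactOpens X) :
    IsCompactOpenBisection (unit '' (V : Set X)) where
  isCompact := V.isCompact.image AmpleGroupoid.continuous_unit
  isOpen := isOpenMap_unit _ V.isOpen
  injOn_src := by
    rintro _ ⟨x, -, rfl⟩ _ ⟨y, -, rfl⟩ h
    exact congrArg unit h
  injOn_tgt := by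
    rintro _ ⟨x, -, rfl⟩ _ ⟨y, -, rfl⟩ h
    exact congrArg unit h

variable (O)

/-- The characteristic function `χ_U` of a set of arrows. -/
def chiFun (U : Set (Arr X)) : ArrowMap O := fun γ => if γ ∈ U then 1 else 0

theorem supportedOn_chiFun (U : Set (Arr X)) : SupportedOn (chiFun O U) U := by
  refine ⟨?_, fun γ h => if_neg h⟩
  refine (O.continuous_one.comp AmpleGroupoid.continuous_tgt).continuousOn.congr fun γ hγ => ?_
  simp [chiFun, hγ]

/-- `χ_U ∈ Γ_c(𝒢, 𝒪)` for a compact open bisection `U`. -/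
def chiSet (U : Set (Arr X)) (hU : IsCompactOpenBisection U) : Gamma O :=
  ⟨chiFun O U, AddSubgroup.subset_closure ⟨U, hU, supportedOn_chiFun O U⟩⟩

/-- `χ_V ∈ Γ_c(𝒢, 𝒪)` for a compact open set `V` of units. -/
def chi (V : CompactOpens X) : Gamma O := chiSet O _ (isCompactOpenBisection_unit V)

variable {O}

theorem chi_mul_apply (V : CompactOpens X) (f : Gamma O) (γ : Arr X) :
    (chi O V * f) γ = if γ.tgt ∈ V then f γ else 0 := by
  obtain ⟨x, y, γ⟩ := γ
  show conv (chiFun O (unit '' (V : Set X))) f (arr γ) = if y ∈ V then f (arr γ) else 0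
  split_ifs with h
  · have h1 := conv_apply_of_injOn_tgt (isCompactOpenBisection_unit V).injOn_tgt
      (supportedOn_chiFun O _).2 f γ (𝟙 y) ⟨y, h, rfl⟩
    have h2 : chiFun O (unit '' (V : Set X)) (arr (𝟙 y)) = 1 := if_pos ⟨y, h, rfl⟩
    rw [h2, one_mul, O.act_id] at h1
    rw [← h1]
    have key : ∀ δ : x ⟶ y, δ = γ → conv (chiFun O (unit '' (V : Set X))) f (arr γ) =
        conv (chiFun O (unit '' (V : Set X))) f (arr δ) := by
      rintro _ rfl
      rfl
    exact key _ (Category.comp_id γ)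
  · refine finsum_eq_zero_of_forall_eq_zero ?_
    rintro ⟨z, β⟩
    have : chiFun O (unit '' (V : Set X)) (arr β) = 0 := by
      refine if_neg ?_
      rintro ⟨t, ht, h'⟩
      obtain rfl : t = y := congrArg Arr.tgt h'
      exact h ht
    simp only [this, zero_mul]

theorem gamma_ext {f g : Gamma O} (h : ∀ γ : Arr X, f γ = g γ) : f = g := Subtype.ext (funext h)

theorem chi_mul_chi (V W : CompactOpens X) : chi O V * chi O W = chi O (V ⊓ W) := by
  refine gamma_ext fun γ => ?_
  rw [chi_mul_apply]
  show (if γ.tgt ∈ V then (if γ ∈ unit '' (W : Set X) then (1 : O.stalk γ.tgt) else 0) else 0) =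
    if γ ∈ unit '' ((V ⊓ W : CompactOpens X) : Set X) then 1 else 0
  by_cases h : ∃ x, unit x = γ
  · obtain ⟨x, rfl⟩ := h
    have hu : ∀ (U : Set X), unit x ∈ unit '' U ↔ x ∈ U := by
      intro U
      constructor
      · rintro ⟨y, hy, h⟩
        obtain rfl : y = x := congrArg Arr.tgt h
        exact hy
      · exact fun h => ⟨x, h, rfl⟩
    have hVW : x ∈ ((V ⊓ W : CompactOpens X) : Set X) ↔ x ∈ V ∧ x ∈ W := by
      rw [CompactOpens.coe_inf]
      rfl
    simp only [hu, hVW]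
    by_cases h1 : x ∈ V <;> by_cases h2 : x ∈ W <;> simp [h1, h2]
  · have hu : ∀ (U : Set X), γ ∉ unit '' U := by
      rintro U ⟨y, hy, h'⟩
      exact h ⟨y, h'⟩
    simp [hu]

/-- `f` is supported on a compact open bisection containing `γ` and takes the value `a` at `γ`. -/
def HasGerm (f : Gamma O) {x y : X} (γ : x ⟶ y) (a : O.stalk y) : Prop :=
  ∃ U : Set (Arr X), IsCompactOpenBisection U ∧ arr γ ∈ U ∧ SupportedOn f.1 U ∧ f (arr γ) = a

theorem hasGerm_chiSet {U : Set (Arr X)} (hU : IsCompactOpenBisection U) {x y : X} {γ : x ⟶ y}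
    (hγ : arr γ ∈ U) : HasGerm (chiSet O U hU) γ 1 :=
  ⟨U, hU, hγ, supportedOn_chiFun O U, if_pos hγ⟩

theorem hasGerm_chi {V : CompactOpens X} {x : X} (hx : x ∈ V) : HasGerm (chi O V) (𝟙 x) 1 :=
  hasGerm_chiSet _ ⟨x, hx, rfl⟩

theorem exists_hasGerm {x y : X} (γ : x ⟶ y) (a : O.stalk y) : ∃ f : Gamma O, HasGerm f γ a := by
  obtain ⟨e, he, hpe⟩ := O.isLocalHomeomorph_pt ⟨y, a⟩
  have hi : Set.InjOn Total.pt e.source := hpe ▸ e.injOn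
  obtain ⟨σ, hσ, hσc⟩ := exists_section_of_isOpenMap O.isLocalHomeomorph_pt.isOpenMap
    e.open_source hi ⟨⟨y, a⟩⟩
  set Q : Set X := Total.pt '' e.source with hQ
  have hQo : IsOpen Q := O.isLocalHomeomorph_pt.isOpenMap _ e.open_source
  have hσp : ∀ t ∈ Q, (σ t).pt = t := by
    rintro _ ⟨u, hu, rfl⟩
    rw [hσ u hu]
  obtain ⟨W, hW, hγW, hWQ⟩ := exists_bisection (hQo.preimage AmpleGroupoid.continuous_tgt)
    (γ := arr γ) ⟨_, he, rfl⟩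
  let f : ArrowMap O := fun δ =>
    if h : δ ∈ W then (hσp δ.tgt (hWQ h)) ▸ (σ δ.tgt).val else 0
  have hf : ∀ δ ∈ W, (⟨δ.tgt, f δ⟩ : Total O.stalk) = σ δ.tgt := by
    intro δ hδ
    simp only [f, hδ, dif_pos]
    have key : ∀ (t : X) (s : Total O.stalk) (h : s.pt = t),
        (⟨t, h ▸ s.val⟩ : Total O.stalk) = s := by
      rintro _ s rfl
      rfl
    exact key _ _ _
  have hfs : SupportedOn f W := by
    refine ⟨?_, fun δ hδ => dif_neg hδ⟩
    exact (hσc.comp AmpleGroupoid.continuous_tgt.continuousOn hWQ).congr hf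
  refine ⟨⟨f, AddSubgroup.subset_closure ⟨W, hW, hfs⟩⟩, W, hW, hγW, hfs, ?_⟩
  have h1 := (hf _ hγW).trans (hσ _ he)
  exact eq_of_heq (Total.mk.inj h1).2

theorem HasGerm.mul {f g : Gamma O} {x y t : X} {γ : y ⟶ t} {δ : x ⟶ y} {a : O.stalk t}
    {b : O.stalk y} (hf : HasGerm f γ a) (hg : HasGerm g δ b) :
    HasGerm (f * g) (δ ≫ γ) (a * O.act γ b) := by
  obtain ⟨U, hU, hγU, hfU, rfl⟩ := hf
  obtain ⟨V, hV, hδV, hgV, rfl⟩ := hg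
  exact ⟨mulSet U V, isCompactOpenBisection_mulSet hU hV, ⟨⟨x, y, t, δ, γ⟩, hγU, hδV, rfl⟩,
    supportedOn_conv hU hV hfU hgV, conv_apply_of_injOn_tgt hU.injOn_tgt hfU.2 g.1 δ γ hγU⟩

theorem HasGerm.congr {f : Gamma O} {x y : X} {γ δ : x ⟶ y} {a b : O.stalk y}
    (hf : HasGerm f γ a) (h : γ = δ) (h' : a = b) : HasGerm f δ b := by
  subst h
  subst h'
  exact hf

theorem SupportedOn.continuousAt {f : ArrowMap O} {U : Set (Arr X)} (h : SupportedOn f U)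
    (hU : IsOpen U) {γ : Arr X} (hγ : γ ∈ U) :
    ContinuousAt (fun γ => (⟨γ.tgt, f γ⟩ : Total O.stalk)) γ :=
  h.1.continuousAt (hU.mem_nhds hγ)

/-- Two functions with the same germ at `γ` agree over a neighbourhood of `r(γ)`. -/
theorem HasGerm.exists_chi_mul_eq {f g : Gamma O} {x y : X} {γ : x ⟶ y} {a : O.stalk y}
    (hf : HasGerm f γ a) (hg : HasGerm g γ a) :
    ∃ V : CompactOpens X, y ∈ V ∧ chi O V * f = chi O V * g := by
  obtain ⟨U, hU, hγU, hfU, hfa⟩ := hf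
  obtain ⟨U', hU', hγU', hgU, hga⟩ := hg
  have h := eventuallyEq_of_isLocalHomeomorph O.isLocalHomeomorph_pt
    (hfU.continuousAt hU.isOpen hγU) (hgU.continuousAt hU'.isOpen hγU')
    (by rw [hfa, hga]) (Filter.Eventually.of_forall fun _ => rfl)
  obtain ⟨G, hG, hGo, hγG⟩ := eventually_nhds_iff.1
    (h.and ((hU.isOpen.eventually_mem hγU).and (hU'.isOpen.eventually_mem hγU')))
  obtain ⟨V, hV, hVG⟩ := exists_compactOpens (isOpenMap_tgt _ hGo) ⟨arr γ, hγG, rfl⟩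
  refine ⟨V, hV, gamma_ext fun δ => ?_⟩
  rw [chi_mul_apply, chi_mul_apply]
  split_ifs with hδ
  · obtain ⟨ε, hε, hεδ⟩ := hVG hδ
    obtain ⟨h1, h2, h3⟩ := hG ε hε
    by_cases hd : δ = ε
    · subst hd
      exact eq_of_heq (Total.mk.inj h1).2
    · have e1 : f δ = 0 := hfU.2 δ fun h => hd (hU.injOn_tgt h h2 hεδ.symm)
      have e2 : g δ = 0 := hgU.2 δ fun h => hd (hU'.injOn_tgt h h3 hεδ.symm)
      rw [e1, e2]
  · rfl

theorem HasGerm.exists_add {f g : Gamma O} {x y : X} {γ : x ⟶ y} {a b : O.stalk y}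
    (hf : HasGerm f γ a) (hg : HasGerm g γ b) :
    ∃ V : CompactOpens X, y ∈ V ∧ HasGerm (chi O V * (f + g)) γ (a + b) := by
  obtain ⟨U, hU, hγU, hfU, rfl⟩ := hf
  obtain ⟨U', hU', hγU', hgU, rfl⟩ := hg
  obtain ⟨W, hW, hγW, hWU⟩ := exists_bisection (hU.isOpen.inter hU'.isOpen) (γ := arr γ)
    ⟨hγU, hγU'⟩
  let V : CompactOpens X :=
    ⟨⟨Arr.tgt '' W, hW.isCompact.image AmpleGroupoid.continuous_tgt⟩, isOpenMap_tgt _ hW.isOpen⟩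
  have hyV : y ∈ V := ⟨arr γ, hγW, rfl⟩
  refine ⟨V, hyV, W, hW, hγW, ⟨?_, ?_⟩, ?_⟩
  · have h1 : ContinuousOn (fun δ : Arr X =>
        (⟨δ.tgt, f δ, g δ⟩ : FiberProd O.stalk O.stalk)) W := by
      rw [continuousOn_iff_continuous_domRestrict, continuous_induced_rng]
      refine Continuous.prodMk ?_ ?_
      · exact (hfU.1.mono fun δ h => (hWU h).1).domRestrict
      · exact (hgU.1.mono fun δ h => (hWU h).2).domRestrict
    refine (O.continuous_add.comp_continuousOn h1).congr fun δ hδ => ?_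
    have : (chi O V * (f + g)).1 δ = f δ + g δ := by
      rw [chi_mul_apply, if_pos ⟨δ, hδ, rfl⟩]
      rfl
    simp only [Function.comp, this]
  · intro δ hδ
    rw [chi_mul_apply]
    split_ifs with h
    · obtain ⟨ε, hε, hεδ⟩ := h
      have hd : δ ≠ ε := fun h => hδ (h ▸ hε)
      have e1 : f δ = 0 := hfU.2 δ fun h => hd (hU.injOn_tgt h (hWU hε).1 hεδ.symm)
      have e2 : g δ = 0 := hgU.2 δ fun h => hd (hU'.injOn_tgt h (hWU hε).2 hεδ.symm)
      show f δ + g δ = 0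
      rw [e1, e2, add_zero]
    · rfl
  · rw [chi_mul_apply, if_pos hyV]
    rfl

end Germs

/-! ### The sheaf of `𝒪`-modules attached to a module -/

section Sh

variable {O} {S : Type z} [AddCommGroup S] (ρ : Gamma O →ₙ+* AddMonoid.End S)

theorem rep_mul (f g : Gamma O) (m : S) : ρ (f * g) m = ρ f (ρ g m) := by
  rw [map_mul, AddMonoid.End.coe_mul, Function.comp_apply]

theorem rep_add (f g : Gamma O) (m : S) : ρ (f + g) m = ρ f m + ρ g m := by
  rw [map_add]
  rfl

/-- `N_x = {m ∈ S | χ_V m = 0 for some compact open set V of units containing x}`. -/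
def nullGerms (x : X) : AddSubgroup S where
  carrier := {m | ∃ V : CompactOpens X, x ∈ V ∧ ρ (chi O V) m = 0}
  zero_mem' := by
    obtain ⟨V, hV, -⟩ := exists_compactOpens isOpen_univ (Set.mem_univ x)
    exact ⟨V, hV, map_zero _⟩
  add_mem' := by
    rintro m n ⟨V, hV, hm⟩ ⟨W, hW, hn⟩
    refine ⟨V ⊓ W, ?_, ?_⟩
    · show x ∈ ((V ⊓ W : CompactOpens X) : Set X)
      rw [CompactOpens.coe_inf]
      exact ⟨hV, hW⟩
    · rw [map_add]
      have h1 : ρ (chi O (V ⊓ W)) m = 0 := by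
        rw [inf_comm, ← chi_mul_chi, rep_mul, hm, map_zero]
      have h2 : ρ (chi O (V ⊓ W)) n = 0 := by
        rw [← chi_mul_chi, rep_mul, hn, map_zero]
      rw [h1, h2, add_zero]
  neg_mem' := by
    rintro m ⟨V, hV, hm⟩
    exact ⟨V, hV, by rw [map_neg, hm, neg_zero]⟩

/-- `S_x = S / N_x`. -/
abbrev GermModule (x : X) : Type z := S ⧸ nullGerms ρ x

/-- The class `[m]_x`. -/
def germ (x : X) (m : S) : GermModule ρ x := QuotientAddGroup.mk m

theorem germ_add (x : X) (m n : S) : germ ρ x (m + n) = germ ρ x m + germ ρ x n := rfl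

theorem germ_surjective {x : X} (s : GermModule ρ x) : ∃ m, germ ρ x m = s :=
  QuotientAddGroup.mk_surjective s

theorem germ_eq_zero {x : X} {m : S} :
    germ ρ x m = 0 ↔ ∃ V : CompactOpens X, x ∈ V ∧ ρ (chi O V) m = 0 :=
  QuotientAddGroup.eq_zero_iff m

theorem germ_eq {x : X} {m n : S} :
    germ ρ x m = germ ρ x n ↔ ∃ V : CompactOpens X, x ∈ V ∧ ρ (chi O V) m = ρ (chi O V) n := by
  rw [← sub_eq_zero]
  show germ ρ x (m - n) = 0 ↔ _
  rw [germ_eq_zero]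
  simp only [map_sub, sub_eq_zero]

theorem germ_chi {x : X} {V : CompactOpens X} (hx : x ∈ V) (m : S) :
    germ ρ x (ρ (chi O V) m) = germ ρ x m := by
  rw [germ_eq]
  refine ⟨V, hx, ?_⟩
  rw [← rep_mul, chi_mul_chi, inf_idem]

theorem germ_eq_of_hasGerm {x y : X} {γ : x ⟶ y} {a : O.stalk y} {f g : Gamma O}
    (hf : HasGerm f γ a) (hg : HasGerm g γ a) (m : S) : germ ρ y (ρ f m) = germ ρ y (ρ g m) := by
  obtain ⟨V, hV, h⟩ := hf.exists_chi_mul_eq hg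
  rw [germ_eq]
  exact ⟨V, hV, by rw [← rep_mul, ← rep_mul, h]⟩

theorem map_nullGerms {x y : X} {γ : x ⟶ y} {a : O.stalk y} {f : Gamma O}
    (hf : HasGerm f γ a) {m : S} (hm : m ∈ nullGerms ρ x) : ρ f m ∈ nullGerms ρ y := by
  obtain ⟨V, hV, h⟩ := hm
  have h1 : HasGerm (f * chi O V) γ a :=
    (hf.mul (hasGerm_chi hV)).congr (Category.id_comp γ) (by rw [map_one, mul_one])
  have h2 := germ_eq_of_hasGerm ρ hf h1 m
  rw [rep_mul, h, map_zero] at h2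
  exact (germ_eq_zero ρ).1 h2

/-- For `γ : x → y` and `a ∈ 𝒪_y`, the map `[m]_x ↦ [f m]_y`, where `f` is any element of
`Γ_c(𝒢, 𝒪)` that is supported on a compact open bisection containing `γ` and has `f(γ) = a`
(see `germAct_germ`). -/
def germAct {x y : X} (γ : x ⟶ y) (a : O.stalk y) : GermModule ρ x →+ GermModule ρ y :=
  QuotientAddGroup.map _ _ (ρ (exists_hasGerm γ a).choose : S →+ S)
    fun _ hm => map_nullGerms ρ (exists_hasGerm γ a).choose_spec hm

theorem germAct_germ {x y : X} {γ : x ⟶ y} {a : O.stalk y} {f : Gamma O} (hf : HasGerm f γ a)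
    (m : S) : germAct ρ γ a (germ ρ x m) = germ ρ y (ρ f m) :=
  germ_eq_of_hasGerm ρ (exists_hasGerm γ a).choose_spec hf m

theorem germAct_id (x : X) (s : GermModule ρ x) : germAct ρ (𝟙 x) 1 s = s := by
  obtain ⟨m, rfl⟩ := germ_surjective ρ s
  obtain ⟨V, hV, -⟩ := exists_compactOpens isOpen_univ (Set.mem_univ x)
  rw [germAct_germ ρ (hasGerm_chi hV), germ_chi ρ hV]

theorem germAct_germAct {x y t : X} (γ : x ⟶ y) (β : y ⟶ t) (a : O.stalk t) (b : O.stalk y)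
    (s : GermModule ρ x) :
    germAct ρ β a (germAct ρ γ b s) = germAct ρ (γ ≫ β) (a * O.act β b) s := by
  obtain ⟨m, rfl⟩ := germ_surjective ρ s
  obtain ⟨f, hf⟩ := exists_hasGerm β a
  obtain ⟨g, hg⟩ := exists_hasGerm γ b
  rw [germAct_germ ρ hg, germAct_germ ρ hf, germAct_germ ρ (hf.mul hg), rep_mul]

theorem germAct_add {x y : X} (γ : x ⟶ y) (a b : O.stalk y) (s : GermModule ρ x) :
    germAct ρ γ (a + b) s = germAct ρ γ a s + germAct ρ γ b s := by
  obtain ⟨m, rfl⟩ := germ_surjective ρ s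
  obtain ⟨f, hf⟩ := exists_hasGerm γ a
  obtain ⟨g, hg⟩ := exists_hasGerm γ b
  obtain ⟨V, hV, h⟩ := hf.exists_add hg
  rw [germAct_germ ρ hf, germAct_germ ρ hg, germAct_germ ρ h, rep_mul, germ_chi ρ hV, rep_add,
    germ_add]

theorem germAct_zero {x y : X} (γ : x ⟶ y) (s : GermModule ρ x) :
    germAct ρ γ (0 : O.stalk y) s = 0 := by
  have h := germAct_add ρ γ (0 : O.stalk y) 0 s
  rw [add_zero] at h
  exact left_eq_add.1 h

/-- The `𝒪_x`-module structure on `S_x`: `r[m]_x = [tm]_x` for a section `t` with `t(x) = r`. -/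
instance germModule (x : X) : Module (O.stalk x) (GermModule ρ x) where
  smul a s := germAct ρ (𝟙 x) a s
  one_smul s := germAct_id ρ x s
  mul_smul a b s := by
    show germAct ρ (𝟙 x) (a * b) s = germAct ρ (𝟙 x) a (germAct ρ (𝟙 x) b s)
    rw [germAct_germAct, O.act_id, Category.comp_id]
  smul_zero a := map_zero _
  smul_add a := map_add _
  add_smul a b s := germAct_add ρ _ a b s
  zero_smul s := germAct_zero ρ _ s

theorem smul_germ {x : X} {a : O.stalk x} {f : Gamma O} (hf : HasGerm f (𝟙 x) a) (m : S) :
    a • germ ρ x m = germ ρ x (ρ f m) := germAct_germ ρ hf m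

/-- The topology on `F = ∐ₓ S_x` generated by the sets `D(m, V) = {[m]_x | x ∈ V}` with `m ∈ S`
and `V` a compact open set of units. -/
instance germTopology : TopologicalSpace (Total (GermModule ρ)) :=
  TopologicalSpace.generateFrom {D | ∃ (m : S) (V : CompactOpens X),
    D = (fun x : X => (⟨x, germ ρ x m⟩ : Total (GermModule ρ))) '' (V : Set X)}

theorem isOpen_setOf_germ_eq (m n : S) : IsOpen {x : X | germ ρ x m = germ ρ x n} := by
  rw [isOpen_iff_mem_nhds]
  intro x hx
  obtain ⟨V, hV, h⟩ := (germ_eq ρ).1 hx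
  filter_upwards [V.isOpen.mem_nhds hV] with y hy
  exact (germ_eq ρ).2 ⟨V, hy, h⟩

/-- The section `x ↦ [m]_x`. -/
def germSection (m : S) (x : X) : Total (GermModule ρ) := ⟨x, germ ρ x m⟩

theorem germSection_pt (s : Total (GermModule ρ)) : ∃ m, germSection ρ m s.pt = s := by
  obtain ⟨x, s⟩ := s
  obtain ⟨m, rfl⟩ := germ_surjective ρ s
  exact ⟨m, rfl⟩

theorem germSection_eq {m n : S} {x y : X} (h : germSection ρ m x = germSection ρ n y) :
    x = y ∧ germ ρ x m = germ ρ x n := by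
  obtain rfl : x = y := congrArg Total.pt h
  exact ⟨rfl, eq_of_heq (Total.mk.inj h).2⟩

theorem continuous_germSection (m : S) : Continuous (germSection ρ m) := by
  refine continuous_generateFrom_iff.2 ?_
  rintro _ ⟨n, V, rfl⟩
  have : germSection ρ m ⁻¹' ((fun x : X => (⟨x, germ ρ x n⟩ : Total (GermModule ρ))) '' V) =
      {x : X | germ ρ x n = germ ρ x m} ∩ V := by
    ext x
    constructor
    · rintro ⟨y, hy, h⟩
      obtain ⟨rfl, h2⟩ := germSection_eq ρ (m := n) (n := m) h
      exact ⟨h2, hy⟩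
    · rintro ⟨h1, h2⟩
      exact ⟨x, h2, congrArg (Total.mk x) h1⟩
  rw [this]
  exact (isOpen_setOf_germ_eq ρ n m).inter V.isOpen

theorem isOpenMap_germSection (m : S) : IsOpenMap (germSection ρ m) := by
  intro G hG
  rw [isOpen_iff_mem_nhds]
  rintro _ ⟨x, hx, rfl⟩
  obtain ⟨V, hV, hVG⟩ := exists_compactOpens hG hx
  have h1 : IsOpen (germSection ρ m '' V) := TopologicalSpace.isOpen_generateFrom_of_mem ⟨m, V, rfl⟩
  exact Filter.mem_of_superset (h1.mem_nhds ⟨x, hV, rfl⟩) (Set.image_mono hVG)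

theorem isOpenEmbedding_germSection (m : S) : IsOpenEmbedding (germSection ρ m) :=
  .of_continuous_injective_isOpenMap (continuous_germSection ρ m)
    (fun _ _ h => (germSection_eq ρ h).1) (isOpenMap_germSection ρ m)

/-- Near `[m]_x`, every point `s` of `F` is `[m]_y` with `y = q(s)`. -/
theorem eventually_eq_germSection (m : S) (x : X) :
    ∀ᶠ s in 𝓝 (germSection ρ m x), s = germSection ρ m s.pt := by
  filter_upwards [(isOpenEmbedding_germSection ρ m).isOpen_range.mem_nhds ⟨x, rfl⟩]
  rintro _ ⟨y, rfl⟩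
  rfl

theorem isLocalHomeomorph_germ_pt :
    IsLocalHomeomorph (Total.pt : Total (GermModule ρ) → X) := by
  refine IsLocalHomeomorph.mk _ fun s => ?_
  obtain ⟨m, hm⟩ := germSection_pt ρ s
  have : Nonempty X := ⟨s.pt⟩
  refine ⟨((isOpenEmbedding_germSection ρ m).toOpenPartialHomeomorph _).symm, ?_, ?_⟩
  · simp only [OpenPartialHomeomorph.symm_source, IsOpenEmbedding.toOpenPartialHomeomorph_target]
    exact ⟨s.pt, hm⟩
  · intro t ht
    simp only [OpenPartialHomeomorph.symm_source,
      IsOpenEmbedding.toOpenPartialHomeomorph_target] at ht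
    obtain ⟨y, rfl⟩ := ht
    exact ((isOpenEmbedding_germSection ρ m).toOpenPartialHomeomorph_left_inv _).symm

theorem continuous_germ_act : Continuous fun p : ActPair (GermModule ρ) =>
    (⟨p.arrow.tgt, germAct ρ p.arrow.hom 1 p.val⟩ : Total (GermModule ρ)) := by
  rw [continuous_iff_continuousAt]
  rintro ⟨γ, s⟩
  obtain ⟨m, rfl⟩ := germ_surjective ρ s
  obtain ⟨U, hU, hγU, -⟩ := exists_bisection isOpen_univ (Set.mem_univ γ)
  have hi := continuous_induced_dom (t := inferInstance)
    (f := fun p : ActPair (GermModule ρ) =>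
      (p.arrow, (⟨p.arrow.src, p.val⟩ : Total (GermModule ρ))))
  have hc1 : Continuous fun p : ActPair (GermModule ρ) => p.arrow := continuous_fst.comp hi
  have hc2 : Continuous fun p : ActPair (GermModule ρ) =>
      (⟨p.arrow.src, p.val⟩ : Total (GermModule ρ)) := continuous_snd.comp hi
  have h1 : ∀ᶠ p in 𝓝 (⟨γ, germ ρ γ.src m⟩ : ActPair (GermModule ρ)), p.arrow ∈ U :=
    hc1.continuousAt.eventually (hU.isOpen.eventually_mem hγU)
  have h2 := (hc2.continuousAt (x := ⟨γ, germ ρ γ.src m⟩)).eventually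
    (show ∀ᶠ s in 𝓝 (⟨γ.src, germ ρ γ.src m⟩ : Total (GermModule ρ)),
      s = germSection ρ m s.pt from eventually_eq_germSection ρ m γ.src)
  have hcont : Continuous fun p : ActPair (GermModule ρ) =>
      germSection ρ (ρ (chiSet O U hU) m) p.arrow.tgt :=
    (continuous_germSection ρ _).comp (AmpleGroupoid.continuous_tgt.comp hc1)
  refine hcont.continuousAt.congr ?_
  filter_upwards [h1, h2]
  rintro ⟨δ, s⟩ h1 h2
  have h3 : s = germ ρ δ.src m := eq_of_heq (Total.mk.inj h2).2
  subst h3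
  refine congrArg (Total.mk δ.tgt) ?_
  exact (germAct_germ ρ (hasGerm_chiSet hU h1) m).symm

theorem continuous_germ_add : Continuous fun p : FiberProd (GermModule ρ) (GermModule ρ) =>
    (⟨p.pt, p.fst + p.snd⟩ : Total (GermModule ρ)) := by
  rw [continuous_iff_continuousAt]
  rintro ⟨x, s, t⟩
  obtain ⟨m, rfl⟩ := germ_surjective ρ s
  obtain ⟨n, rfl⟩ := germ_surjective ρ t
  have hi := continuous_induced_dom (t := inferInstance)
    (f := fun p : FiberProd (GermModule ρ) (GermModule ρ) =>
      ((⟨p.pt, p.fst⟩ : Total (GermModule ρ)), (⟨p.pt, p.snd⟩ : Total (GermModule ρ))))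
  have hc1 := continuous_fst.comp hi
  have hc2 := continuous_snd.comp hi
  have h1 := (hc1.continuousAt (x := ⟨x, germ ρ x m, germ ρ x n⟩)).eventually
    (eventually_eq_germSection ρ m x)
  have h2 := (hc2.continuousAt (x := ⟨x, germ ρ x m, germ ρ x n⟩)).eventually
    (eventually_eq_germSection ρ n x)
  have hcont : Continuous fun p : FiberProd (GermModule ρ) (GermModule ρ) =>
      germSection ρ (m + n) p.pt :=
    (continuous_germSection ρ _).comp ((isLocalHomeomorph_germ_pt ρ).continuous.comp hc1)
  refine hcont.continuousAt.congr ?_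
  filter_upwards [h1, h2]
  rintro ⟨y, s, t⟩ h1 h2
  have h3 : s = germ ρ y m := eq_of_heq (Total.mk.inj h1).2
  have h4 : t = germ ρ y n := eq_of_heq (Total.mk.inj h2).2
  subst h3 h4
  rfl

theorem continuous_germ_smul : Continuous fun p : FiberProd O.stalk (GermModule ρ) =>
    (⟨p.pt, p.fst • p.snd⟩ : Total (GermModule ρ)) := by
  rw [continuous_iff_continuousAt]
  rintro ⟨x, a, t⟩
  obtain ⟨n, rfl⟩ := germ_surjective ρ t
  obtain ⟨f, U, hU, hxU, hfU, hfx⟩ := exists_hasGerm (𝟙 x) a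
  have hi := continuous_induced_dom (t := inferInstance)
    (f := fun p : FiberProd O.stalk (GermModule ρ) =>
      ((⟨p.pt, p.fst⟩ : Total O.stalk), (⟨p.pt, p.snd⟩ : Total (GermModule ρ))))
  have hc1 := continuous_fst.comp hi
  have hc2 := continuous_snd.comp hi
  have hpt : Continuous fun p : FiberProd O.stalk (GermModule ρ) => p.pt :=
    O.isLocalHomeomorph_pt.continuous.comp hc1
  have hun : Continuous fun p : FiberProd O.stalk (GermModule ρ) => unit p.pt :=
    AmpleGroupoid.continuous_unit.comp hpt
  have h0 : ∀ᶠ p in 𝓝 (⟨x, a, germ ρ x n⟩ : FiberProd O.stalk (GermModule ρ)), unit p.pt ∈ U :=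
    hun.continuousAt.eventually (hU.isOpen.eventually_mem hxU)
  have hfc : ContinuousAt (fun p : FiberProd O.stalk (GermModule ρ) =>
      (⟨p.pt, f (unit p.pt)⟩ : Total O.stalk)) ⟨x, a, germ ρ x n⟩ :=
    ContinuousAt.comp (g := fun γ : Arr X => (⟨γ.tgt, f γ⟩ : Total O.stalk))
      (x := (⟨x, a, germ ρ x n⟩ : FiberProd O.stalk (GermModule ρ)))
      (hfU.continuousAt hU.isOpen hxU) (f := fun p : FiberProd O.stalk (GermModule ρ) => unit p.pt) hun.continuousAt
  have h1 := eventuallyEq_of_isLocalHomeomorph O.isLocalHomeomorph_pt hfc hc1.continuousAt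
    (congrArg (Total.mk x) hfx) (Filter.Eventually.of_forall fun _ => rfl)
  have h2 := (hc2.continuousAt (x := ⟨x, a, germ ρ x n⟩)).eventually
    (eventually_eq_germSection ρ n x)
  have hcont : Continuous fun p : FiberProd O.stalk (GermModule ρ) =>
      germSection ρ (ρ f n) p.pt :=
    (continuous_germSection ρ _).comp hpt
  refine hcont.continuousAt.congr ?_
  filter_upwards [h0, h1, h2]
  rintro ⟨y, b, t⟩ h0 h1 h2
  have h3 : f (unit y) = b := eq_of_heq (Total.mk.inj h1).2
  have h4 : t = germ ρ y n := eq_of_heq (Total.mk.inj h2).2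
  subst h4
  exact congrArg (Total.mk y) (smul_germ ρ ⟨U, hU, h0, hfU, h3⟩ n).symm

/-- The `𝒢`-sheaf of `𝒪`-modules `Sh(S) = (F, q, β)` attached to a `Γ_c(𝒢, 𝒪)`-module `S`: the
stalk at `x` is `S_x`, and `β_γ([m]_{d(γ)}) = [χ_U m]_{r(γ)}` for a compact open bisection `U ∋ γ`. -/
def sheafOfModule : SheafOfModules.{u, v, w, z} O where
  stalk := GermModule ρ
  isLocalHomeomorph_pt := isLocalHomeomorph_germ_pt ρ
  act γ := germAct ρ γ 1
  act_id x s := germAct_id ρ x s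
  act_comp γ β s := by rw [germAct_germAct, map_one, mul_one]
  act_smul := by
    intro x y γ a s
    show germAct ρ γ 1 (germAct ρ (𝟙 x) a s) = germAct ρ (𝟙 y) (O.act γ a) (germAct ρ γ 1 s)
    rw [germAct_germAct, germAct_germAct, map_one, mul_one, one_mul, Category.id_comp,
      Category.comp_id]
  continuous_act := continuous_germ_act ρ
  continuous_add := continuous_germ_add ρ
  continuous_smul := continuous_germ_smul ρ

theorem sheafOfModule_act_germ {U : Set (Arr X)} (hU : IsCompactOpenBisection U) {x y : X}
    {γ : x ⟶ y} (hγ : arr γ ∈ U) (m : S) :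
    (sheafOfModule ρ).act γ (germ ρ x m) = germ ρ y (ρ (chiSet O U hU) m) :=
  germAct_germ ρ (hasGerm_chiSet hU hγ) m

end Sh

section StalkModule

variable {O}

/-- The isotropy group acts on the stalk `ℳ_x` by `β`. -/
def SheafOfModules.isotropyHom (M : SheafOfModules.{u, v, w, z} O) (x : X) :
    End x →* AddMonoid.End (M.stalk x) where
  toFun δ := M.act (End.asHom δ)
  map_one' := AddMonoidHom.ext fun m => M.act_id x m
  map_mul' β γ := AddMonoidHom.ext fun m => (M.act_comp (End.asHom γ) (End.asHom β) m).symm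

/-- The action of `B_x` on the stalk `ℳ_x`, `bδ · m = b β_δ(m)`. -/
def SheafOfModules.stalkHom (M : SheafOfModules.{u, v, w, z} O) (x : X) :
    IsotropyRing O x →+* AddMonoid.End (M.stalk x) :=
  SkewMonoidAlgebra.liftNCRingHom (Module.toAddMonoidEnd (O.stalk x) (M.stalk x))
    (M.isotropyHom x) (by
      intro b δ
      exact AddMonoidHom.ext fun m => (M.act_smul (End.asHom δ) b m).symm)

/-- The left `B_x`-module structure on the stalk `ℳ_x`. -/
instance SheafOfModules.stalkModule (M : SheafOfModules.{u, v, w, z} O) (x : X) :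
    Module (IsotropyRing O x) (M.stalk x) :=
  Module.compHom (M.stalk x) (M.stalkHom x)

theorem SheafOfModules.single_smul (M : SheafOfModules.{u, v, w, z} O) {x : X} (δ : End x)
    (b : O.stalk x) (m : M.stalk x) :
    (SkewMonoidAlgebra.single δ b : IsotropyRing O x) • m = b • M.act (End.asHom δ) m := by
  have h : M.stalkHom x (SkewMonoidAlgebra.single δ b) =
      Module.toAddMonoidEnd (O.stalk x) (M.stalk x) b * M.isotropyHom x δ :=
    SkewMonoidAlgebra.liftNC_single _ _ _ _
  show M.stalkHom x (SkewMonoidAlgebra.single δ b) m = _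
  rw [h]
  rfl

end StalkModule

end AmpleSheaf

end

open CategoryTheory AmpleSheaf

/-!
Let `M` be a `𝒢`-sheaf of `𝒪`-modules. Choosing an arrow `x → y` for every `y` in the orbit of `x`
identifies `Ind_x(M_x)` with `⨁ M_y`, the sum over the orbit, and `f` acts on it through the blocks
`f_{zy} : M_y → M_z`, `s ↦ ∑_{β : y → z} f(β) β(s)`. So `f` annihilates `Ind_x(M_x)` iff its blocks
over the orbit vanish. When `M = Sh(S)` the germs satisfy `[f m]_z = ∑_y f_{zy} [m]_y`, and
multiplying `m` by a suitable `χ_V` isolates any one summand; so the blocks over the orbit vanish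
iff `f S` lies in the submodule of those `m` whose germs vanish on the orbit. If `S` is simple and
`S_x ≠ 0`, that submodule is zero.

The unitary law `RS = S` enters only through local units: each `m` is fixed by some `χ_V`, and if
all germs of `m` vanish then `V` is covered by finitely many compact open `W` with `χ_W m = 0`, so
`m = χ_V m = 0`.
-/

noncomputable section

namespace AmpleSheaf

theorem finsum_comp_of_injective {ι κ A : Type*} [AddCommMonoid A] {g : κ → ι}
    (hg : Function.Injective g) {f : ι → A} (hf : Function.support f ⊆ Set.range g) :
    ∑ᶠ k, f (g k) = ∑ᶠ i, f i := by
  rw [← finsum_mem_range hg, ← finsum_mem_univ f]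
  exact finsum_mem_inter_support_eq' f _ _ fun i hi => by simp only [hf hi, Set.mem_univ]

theorem eventually_apply_eq_self_of_closure_eq_top {ι A : Type*} {l : Filter ι} [AddGroup A]
    {e : ι → A →+ A} {T : Set A} (hT : AddSubgroup.closure T = ⊤)
    (h : ∀ t ∈ T, ∀ᶠ i in l, e i t = t) (a : A) : ∀ᶠ i in l, e i a = a := by
  have ha : a ∈ AddSubgroup.closure T := hT ▸ AddSubgroup.mem_top a
  induction ha using AddSubgroup.closure_induction with
  | mem t ht => exact h t ht
  | zero => exact .of_forall fun i => map_zero (e i)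
  | add a b _ _ ha hb =>
    filter_upwards [ha, hb] with i hai hbi
    rw [map_add, hai, hbi]
  | neg a _ ha =>
    filter_upwards [ha] with i hai
    rw [map_neg, hai]

section BalancedTensor

variable {B L M A : Type*} [Ring B] [AddCommGroup L] [Module Bᵐᵒᵖ L] [AddCommGroup M] [Module B M]
  [AddCommGroup A]

variable (B L M) in
/-- The universal balanced map `(ξ, m) ↦ ξ ⊗ m` into `L ⊗_B M`. -/
def balancedTmul : L →+ M →+ BalancedTensor B L M :=
  (AddMonoidHom.compHom (QuotientAddGroup.mk' (balancedSubgroup B L M))).comp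
    (LinearMap.toAddMonoidHom'.comp (TensorProduct.mk ℤ L M).toAddMonoidHom)

theorem balancedTmul_op_smul (ξ : L) (b : B) (m : M) :
    balancedTmul B L M (MulOpposite.op b • ξ) m = balancedTmul B L M ξ (b • m) :=
  sub_eq_zero.1 <|
    (QuotientAddGroup.eq_zero_iff _).2 (AddSubgroup.subset_closure ⟨ξ, b, m, rfl⟩)

/-- The additive map out of `L ⊗_B M` given by a balanced biadditive map. -/
def balancedLift (Φ : L →+ M →+ A)
    (hΦ : ∀ (ξ : L) (b : B) (m : M), Φ (MulOpposite.op b • ξ) m = Φ ξ (b • m)) :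
    BalancedTensor B L M →+ A :=
  QuotientAddGroup.lift _
    (TensorProduct.liftAddHom (R := ℤ) Φ fun n ξ m => by
      rw [map_zsmul, map_zsmul, AddMonoidHom.zsmul_apply]) <| by
    refine (AddSubgroup.closure_le _).2 ?_
    rintro _ ⟨ξ, b, m, rfl⟩
    rw [SetLike.mem_coe, AddMonoidHom.mem_ker, map_sub, TensorProduct.liftAddHom_tmul,
      TensorProduct.liftAddHom_tmul, hΦ, sub_self]

theorem balancedTensor_hom_ext {φ ψ : BalancedTensor B L M →+ A}
    (h : ∀ ξ m, φ (balancedTmul B L M ξ m) = ψ (balancedTmul B L M ξ m)) : φ = ψ :=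
  QuotientAddGroup.addMonoidHom_ext _ <| AddMonoidHom.toIntLinearMap_injective <|
    TensorProduct.ext' h

end BalancedTensor

/-- The orbit of the unit `x`. -/
def orbit {X : Type u} [Groupoid.{v} X] (x : X) : Set X := {y | Nonempty (x ⟶ y)}

variable {X : Type u} [TopologicalSpace X] [Groupoid.{v} X] [AmpleGroupoid X]
  {O : SheafOfRings.{u, v, w} X}

section Induction

theorem closure_gamma_generators :
    AddSubgroup.closure
      {f : Gamma O | ∃ U : Set (Arr X), IsCompactOpenBisection U ∧ SupportedOn f.1 U} = ⊤ :=
  AddSubgroup.closure_closure_coe_preimage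

theorem gamma_hom_ext {A : Type*} [AddMonoid A] {φ ψ : Gamma O →+ A}
    (h : ∀ (f : Gamma O) (U : Set (Arr X)), IsCompactOpenBisection U → SupportedOn f.1 U →
      φ f = ψ f) : φ = ψ :=
  AddMonoidHom.eq_of_eqOn_dense closure_gamma_generators fun f ⟨U, hU, hf⟩ => h f U hU hf

variable (O) in
/-- The element `a1_γ ⊗ m` of `Ind_x(M)`. -/
def indSingle {x y : X} (γ : x ⟶ y) {M : Type z} [AddCommGroup M] [Module (IsotropyRing O x) M] :
    O.stalk y →+ M →+ IndModule O x M :=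
  (balancedTmul (IsotropyRing O x) (LMod O x) M).comp (lsingle O γ)

variable {x : X} {M : Type z} [AddCommGroup M] [Module (IsotropyRing O x) M]

theorem indModule_ext {A : Type*} [AddCommGroup A] {φ ψ : IndModule O x M →+ A}
    (h : ∀ (y : X) (γ : x ⟶ y) (a : O.stalk y) (m : M),
      φ (indSingle O γ a m) = ψ (indSingle O γ a m)) : φ = ψ := by
  refine balancedTensor_hom_ext fun ξ m => ?_
  have hflip : (φ.comp ((balancedTmul (IsotropyRing O x) (LMod O x) M).flip m)) =
      ψ.comp ((balancedTmul (IsotropyRing O x) (LMod O x) M).flip m) :=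
    lmod_hom_ext fun y γ a => h y γ a m
  exact DFunLike.congr_fun hflip ξ

theorem indSingle_single_smul {y : X} (γ : x ⟶ y) (a : O.stalk y) (δ : End x) (b : O.stalk x)
    (m : M) :
    indSingle O γ a ((SkewMonoidAlgebra.single δ b : IsotropyRing O x) • m) =
      indSingle O (End.asHom δ ≫ γ) (a * O.act γ b) m := by
  rw [indSingle, AddMonoidHom.comp_apply, ← balancedTmul_op_smul, op_single_smul_lsingle]
  rfl

theorem ind_indSingle (f : Gamma O) {y : X} (γ : x ⟶ y) (a : O.stalk y) (m : M) :
    ind O x M f (indSingle O γ a m) =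
      ∑ᶠ β : (Σ z : X, (y ⟶ z)), indSingle O (γ ≫ β.2) (f (arr β.2) * O.act β.2 a) m := by
  have hfin : (Function.support fun β : (Σ z : X, (y ⟶ z)) =>
      lsingle O (γ ≫ β.2) (f (arr β.2) * O.act β.2 a)).Finite := by
    refine (finite_out f.2 y).subset fun β hβ h => hβ ?_
    simp only [h, zero_mul, map_zero]
  have hmul : ind O x M f (indSingle O γ a m) =
      (balancedTmul (IsotropyRing O x) (LMod O x) M).flip m (lmul x f (lsingle O γ a)) := rfl
  rw [hmul, lmul_lsingle_eq_finsum, AddMonoidHom.map_finsum _ hfin]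
  rfl

end Induction

section Blocks

variable (M : SheafOfModules.{u, v, w, z} O)

/-- The additive map `s ↦ a β_γ(s)` from `M_x` to `M_y`, for an arrow `γ : x → y` and `a ∈ 𝒪_y`. -/
def SheafOfModules.smulAct {x y : X} (γ : x ⟶ y) : O.stalk y →+ M.stalk x →+ M.stalk y :=
  (AddMonoidHom.compHom' (M.act γ)).comp (smulAddHom (O.stalk y) (M.stalk y))

theorem SheafOfModules.smulAct_apply {x y : X} (γ : x ⟶ y) (a : O.stalk y) (s : M.stalk x) :
    M.smulAct γ a s = a • M.act γ s :=
  rfl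

theorem SheafOfModules.smulAct_smulAct {x y z : X} (γ : x ⟶ y) (β : y ⟶ z) (a : O.stalk z)
    (b : O.stalk y) (s : M.stalk x) :
    M.smulAct β a (M.smulAct γ b s) = M.smulAct (γ ≫ β) (a * O.act β b) s := by
  simp only [smulAct_apply, act_smul, act_comp, mul_smul]

theorem SheafOfModules.smulAct_id_one (x : X) (s : M.stalk x) : M.smulAct (𝟙 x) 1 s = s := by
  rw [smulAct_apply, act_id, one_smul]

theorem SheafOfModules.smulAct_one_surjective {x y : X} (γ : x ⟶ y) :
    Function.Surjective (M.smulAct γ 1) := fun s =>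
  ⟨M.smulAct (Groupoid.inv γ) 1 s, by
    rw [smulAct_smulAct, one_mul, map_one, Groupoid.inv_comp, smulAct_id_one]⟩

/-- The block `f_{zy} : M_y → M_z`, `s ↦ ∑ f(β) β(s)` over the arrows `β : y → z`, of the action of
`f` on `⨁ M_y`. -/
def SheafOfModules.block (f : Gamma O) (y z : X) : M.stalk y →+ M.stalk z :=
  ∑ᶠ β : y ⟶ z, M.smulAct β (f (arr β))

theorem SheafOfModules.finite_support_smulAct (f : Gamma O) (y z : X) :
    (Function.support fun β : y ⟶ z => M.smulAct β (f (arr β))).Finite := by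
  refine ((finite_into f.2 z).preimage (sigma_mk_injective (i := y)).injOn).subset
    fun β hβ h => hβ ?_
  simp only [h, map_zero]

theorem SheafOfModules.block_apply (f : Gamma O) {y z : X} (s : M.stalk y) :
    M.block f y z s = ∑ᶠ β : y ⟶ z, M.smulAct β (f (arr β)) s :=
  (AddMonoidHom.eval s).map_finsum (M.finite_support_smulAct f y z)

theorem SheafOfModules.block_add (f g : Gamma O) (y z : X) :
    M.block (f + g) y z = M.block f y z + M.block g y z := by
  rw [block, block, block, ← finsum_add_distrib (M.finite_support_smulAct f y z)
    (M.finite_support_smulAct g y z)]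
  exact finsum_congr fun β => map_add _ _ _

theorem SheafOfModules.block_eq_zero {f : Gamma O} {y z : X} (h : ∀ β : y ⟶ z, f (arr β) = 0) :
    M.block f y z = 0 :=
  finsum_eq_zero_of_forall_eq_zero fun β => by rw [h, map_zero]

theorem SheafOfModules.finite_block_ne_zero (f : Gamma O) (z : X) :
    {y | M.block f y z ≠ 0}.Finite := by
  refine ((finite_into f.2 z).image Sigma.fst).subset fun y hy => ?_
  by_contra hf
  exact hy (M.block_eq_zero fun β => by_contra fun hβ => hf ⟨⟨y, β⟩, hβ, rfl⟩)

theorem SheafOfModules.finite_support_block_apply (f : Gamma O) (z : X) (s : ∀ y, M.stalk y) :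
    (Function.support fun y => M.block f y z (s y)).Finite :=
  (M.finite_block_ne_zero f z).subset fun y hy h => hy (by simp only [h, AddMonoidHom.zero_apply])

theorem SheafOfModules.block_of_injOn_tgt {f : Gamma O} {U : Set (Arr X)}
    (hU : Set.InjOn Arr.tgt U) (hf : ∀ γ, γ ∉ U → f γ = 0) {y z : X} {β : y ⟶ z}
    (hβ : arr β ∈ U) : M.block f y z = M.smulAct β (f (arr β)) := by
  refine finsum_eq_single _ β fun β' hne => ?_
  have hβ' : arr β' ∉ U := fun h => by
    have heq : arr β' = arr β := hU h hβ rfl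
    cases heq
    exact hne rfl
  rw [hf _ hβ', map_zero]

end Blocks

section OrbitSum

variable (M : SheafOfModules.{u, v, w, z} O)

theorem SheafOfModules.block_eq_zero_of_notMem_orbit (f : Gamma O) {x y z : X} (hy : y ∉ orbit x)
    (hz : z ∈ orbit x) : M.block f y z = 0 :=
  M.block_eq_zero fun β => absurd (hz.map fun γ => γ ≫ Groupoid.inv β) hy

variable (x : X)

/-- The balanced map `(a1_γ, s) ↦ a β_γ(s) ∈ M_{r(γ)}`. -/
def orbitPairing : LMod O x →+ M.stalk x →+ ⨁ y : orbit x, M.stalk y :=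
  DirectSum.toAddMonoid fun γ : (Σ y : X, (x ⟶ y)) =>
    (AddMonoidHom.compHom
      (DirectSum.of (fun y : orbit x => M.stalk y) ⟨γ.1, ⟨γ.2⟩⟩)).comp (M.smulAct γ.2)

variable {x}

theorem orbitPairing_lsingle {y : X} (γ : x ⟶ y) (a : O.stalk y) (s : M.stalk x) :
    orbitPairing M x (lsingle O γ a) s =
      DirectSum.of (fun y : orbit x => M.stalk y) ⟨y, ⟨γ⟩⟩ (M.smulAct γ a s) := by
  rw [orbitPairing, lsingle, DirectSum.toAddMonoid_of]
  rfl

theorem orbitPairing_op_smul (ξ : LMod O x) (b : IsotropyRing O x) (s : M.stalk x) :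
    orbitPairing M x (MulOpposite.op b • ξ) s = orbitPairing M x ξ (b • s) := by
  induction b using SkewMonoidAlgebra.induction_on with
  | zero => simp only [MulOpposite.op_zero, zero_smul, map_zero, AddMonoidHom.zero_apply]
  | single δ b =>
    induction ξ using DirectSum.induction_on with
    | zero => simp only [smul_zero, map_zero, AddMonoidHom.zero_apply]
    | of γ a =>
      change orbitPairing M x (_ • lsingle O γ.2 a) s = orbitPairing M x (lsingle O γ.2 a) _
      rw [op_single_smul_lsingle, orbitPairing_lsingle, orbitPairing_lsingle, M.single_smul,
        ← M.smulAct_apply, M.smulAct_smulAct]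
    | add ξ ζ hξ hζ =>
      rw [smul_add, map_add, map_add, AddMonoidHom.add_apply, AddMonoidHom.add_apply, hξ, hζ]
  | add b c hb hc =>
    rw [MulOpposite.op_add, add_smul, add_smul, map_add, map_add, AddMonoidHom.add_apply, hb, hc]

variable (x) in
/-- The additive map `Ind_x(M_x) → ⨁ M_y`, `a1_γ ⊗ s ↦ a β_γ(s)`. -/
def indToOrbitSum : IndModule O x (M.stalk x) →+ ⨁ y : orbit x, M.stalk y :=
  balancedLift (orbitPairing M x) (orbitPairing_op_smul M)

theorem indToOrbitSum_indSingle {y : X} (γ : x ⟶ y) (a : O.stalk y) (s : M.stalk x) :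
    indToOrbitSum M x (indSingle O γ a s) =
      DirectSum.of (fun y : orbit x => M.stalk y) ⟨y, ⟨γ⟩⟩ (M.smulAct γ a s) :=
  orbitPairing_lsingle M γ a s

theorem indSingle_eq_indSingle_one {y : X} (γ δ : x ⟶ y) (a : O.stalk y) (s : M.stalk x) :
    indSingle O γ a s =
      indSingle O δ 1 (M.smulAct (Groupoid.inv δ) 1 (M.smulAct γ a s)) := by
  -- `γ = δ(δ⁻¹γ)`, and `δ⁻¹γ` lies in the isotropy group, so it moves across the tensor sign.
  have hsmul := M.single_smul (End.of (γ ≫ Groupoid.inv δ)) (O.act (Groupoid.inv δ) a) s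
  have hγ : End.asHom (End.of (γ ≫ Groupoid.inv δ)) ≫ δ = γ := by
    change (γ ≫ Groupoid.inv δ) ≫ δ = γ
    rw [Category.assoc, Groupoid.inv_comp, Category.comp_id]
  have hone : M.smulAct (Groupoid.inv δ) 1 (M.smulAct γ a s) =
      (SkewMonoidAlgebra.single (End.of (γ ≫ Groupoid.inv δ)) (O.act (Groupoid.inv δ) a) :
        IsotropyRing O x) • s := by
    rw [M.smulAct_smulAct, one_mul]
    exact hsmul.symm
  rw [hone, indSingle_single_smul, one_mul, O.act_comp, Groupoid.inv_comp, O.act_id]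
  exact DFunLike.congr_fun (congrArg (fun ε => indSingle O ε a) hγ.symm) s

variable (x) in
/-- The inverse of `indToOrbitSum`, `s ↦ 1_δ ⊗ β_δ⁻¹(s)` for `s ∈ M_y`, where `δ : x → y` is a
chosen arrow. -/
def orbitSumToInd : (⨁ y : orbit x, M.stalk y) →+ IndModule O x (M.stalk x) :=
  DirectSum.toAddMonoid fun y => (indSingle O y.2.some 1).comp (M.smulAct (Groupoid.inv y.2.some) 1)

theorem orbitSumToInd_indToOrbitSum (t : IndModule O x (M.stalk x)) :
    orbitSumToInd M x (indToOrbitSum M x t) = t := by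
  suffices h : (orbitSumToInd M x).comp (indToOrbitSum M x) = AddMonoidHom.id _ from
    DFunLike.congr_fun h t
  refine indModule_ext fun y γ a s => ?_
  rw [AddMonoidHom.comp_apply, indToOrbitSum_indSingle, orbitSumToInd, DirectSum.toAddMonoid_of]
  exact (indSingle_eq_indSingle_one M γ _ a s).symm

theorem indToOrbitSum_injective : Function.Injective (indToOrbitSum M x) :=
  Function.LeftInverse.injective (orbitSumToInd_indToOrbitSum M)

theorem indToOrbitSum_ind_indSingle (f : Gamma O) {y : X} (γ : x ⟶ y) (a : O.stalk y)
    (s : M.stalk x) (z : orbit x) :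
    indToOrbitSum M x (ind O x _ f (indSingle O γ a s)) z = M.block f y z (M.smulAct γ a s) := by
  have hfin : (Function.support fun β : (Σ z : X, (y ⟶ z)) =>
      indSingle (M := M.stalk x) O (γ ≫ β.2) (f (arr β.2) * O.act β.2 a) s).Finite := by
    refine (finite_out f.2 y).subset fun β hβ h => hβ ?_
    simp only [h, zero_mul, map_zero, AddMonoidHom.zero_apply]
  have hcoord := ((DFinsupp.evalAddMonoidHom z).comp (indToOrbitSum M x)).map_finsum hfin
  rw [ind_indSingle, M.block_apply]
  refine hcoord.trans ?_
  rw [← finsum_comp_of_injective (sigma_mk_injective (i := z.1))]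
  · refine finsum_congr fun β => ?_
    change indToOrbitSum M x (indSingle O (γ ≫ β) (f (arr β) * O.act β a) s) z = _
    rw [indToOrbitSum_indSingle, M.smulAct_smulAct]
    exact DirectSum.of_eq_same _ _
  · rintro ⟨z', β⟩ hβ
    by_contra hz
    refine hβ ?_
    change indToOrbitSum M x (indSingle O (γ ≫ β) (f (arr β) * O.act β a) s) z = 0
    rw [indToOrbitSum_indSingle]
    refine DirectSum.of_eq_of_ne _ _ _ fun h => hz ?_
    subst h
    exact ⟨β, rfl⟩

theorem mem_annihilator_ind_iff_block {f : Gamma O} :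
    f ∈ annihilator (ind O x (M.stalk x)) ↔ ∀ y z : orbit x, M.block f y z = 0 := by
  rw [annihilator, TwoSidedIdeal.mem_ker]
  constructor
  · rintro hf ⟨y, ⟨γ⟩⟩ z
    ext s
    obtain ⟨s, rfl⟩ := M.smulAct_one_surjective γ s
    rw [← indToOrbitSum_ind_indSingle, hf, AddMonoid.End.zero_apply, map_zero]
    rfl
  · intro hf
    refine indModule_ext fun y γ a s => indToOrbitSum_injective M (DFinsupp.ext fun z => ?_)
    refine (indToOrbitSum_ind_indSingle M f γ a s z).trans ?_
    rw [hf ⟨y, ⟨γ⟩⟩ z]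
    exact (DFunLike.congr_fun (map_zero (indToOrbitSum M x)) z).symm

end OrbitSum

section Germs

variable {S : Type z} [AddCommGroup S] (ρ : Gamma O →ₙ+* AddMonoid.End S)

/-- The map `m ↦ [m]_x`, as an additive homomorphism onto the stalk of `Sh(S)` at `x`. -/
def stalkGerm (x : X) : S →+ (sheafOfModule ρ).stalk x :=
  QuotientAddGroup.mk' (nullGerms ρ x)

variable {ρ}

theorem stalkGerm_surjective {x : X} : Function.Surjective (stalkGerm ρ x) :=
  QuotientAddGroup.mk'_surjective _

theorem stalkGerm_eq_zero {x : X} {m : S} :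
    stalkGerm ρ x m = 0 ↔ ∃ V : CompactOpens X, x ∈ V ∧ ρ (chi O V) m = 0 :=
  germ_eq_zero ρ

theorem stalkGerm_rep_chi_of_mem {x : X} {V : CompactOpens X} (hx : x ∈ V) (m : S) :
    stalkGerm ρ x (ρ (chi O V) m) = stalkGerm ρ x m :=
  germ_chi ρ hx m

theorem smulAct_stalkGerm {x y : X} {γ : x ⟶ y} {a : O.stalk y} {f : Gamma O}
    (hf : HasGerm f γ a) (m : S) :
    (sheafOfModule ρ).smulAct γ a (stalkGerm ρ x m) = stalkGerm ρ y (ρ f m) := by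
  have hcomp : germAct ρ (𝟙 y) a (germAct ρ γ 1 (germ ρ x m)) = germAct ρ γ a (germ ρ x m) := by
    rw [germAct_germAct, map_one, mul_one, Category.comp_id]
  exact hcomp.trans (germAct_germ ρ hf m)

theorem stalkGerm_rep_eq_zero {V : Set X} (hV : IsClosed V) {f : Gamma O} {x : X} (hx : x ∉ V)
    (hf : ∀ γ, γ.tgt ∉ V → f γ = 0) (m : S) : stalkGerm ρ x (ρ f m) = 0 := by
  obtain ⟨W, hxW, hWV⟩ := exists_compactOpens hV.isOpen_compl hx
  have hmul : chi O W * f = 0 := gamma_ext fun γ => by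
    rw [chi_mul_apply]
    split_ifs with hγ
    · exact hf γ (hWV hγ)
    · rfl
  refine stalkGerm_eq_zero.2 ⟨W, hxW, ?_⟩
  rw [← rep_mul, hmul, map_zero, AddMonoid.End.zero_apply]

theorem stalkGerm_rep_chi_of_notMem {x : X} {V : CompactOpens X} (hx : x ∉ V) (m : S) :
    stalkGerm ρ x (ρ (chi O V) m) = 0 := by
  refine stalkGerm_rep_eq_zero V.isCompact.isClosed hx (fun γ hγ => if_neg ?_) m
  rintro ⟨y, hy, rfl⟩
  exact hγ hy

theorem stalkGerm_rep_of_supportedOn {f : Gamma O} {U : Set (Arr X)}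
    (hU : IsCompactOpenBisection U) (hf : SupportedOn f.1 U) (z : X) (m : S) :
    stalkGerm ρ z (ρ f m) = ∑ᶠ y, (sheafOfModule ρ).block f y z (stalkGerm ρ y m) := by
  by_cases hz : z ∈ Arr.tgt '' U
  · obtain ⟨⟨y, z, β⟩, hβ, rfl⟩ := hz
    rw [finsum_eq_single _ y, (sheafOfModule ρ).block_of_injOn_tgt hU.injOn_tgt hf.2 hβ]
    · exact (smulAct_stalkGerm ⟨U, hU, hβ, hf, rfl⟩ m).symm
    · intro y' hy'
      rw [(sheafOfModule ρ).block_eq_zero fun β' => hf.2 _ fun hβ' =>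
        hy' (congrArg Arr.src (hU.injOn_tgt hβ' hβ rfl)), AddMonoidHom.zero_apply]
  · have hclosed : IsClosed (Arr.tgt '' U) :=
      (hU.isCompact.image AmpleGroupoid.continuous_tgt).isClosed
    rw [stalkGerm_rep_eq_zero hclosed hz fun γ hγ => hf.2 γ fun h => hγ ⟨γ, h, rfl⟩]
    refine (finsum_eq_zero_of_forall_eq_zero fun y => ?_).symm
    rw [(sheafOfModule ρ).block_eq_zero fun β => hf.2 _ fun hβ => hz ⟨_, hβ, rfl⟩,
      AddMonoidHom.zero_apply]

theorem stalkGerm_rep (f : Gamma O) (z : X) (m : S) :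
    stalkGerm ρ z (ρ f m) = ∑ᶠ y, (sheafOfModule ρ).block f y z (stalkGerm ρ y m) := by
  let lhs : Gamma O →+ (sheafOfModule ρ).stalk z :=
    AddMonoidHom.mk' (fun f => stalkGerm ρ z (ρ f m)) fun f g => by rw [rep_add, map_add]
  let rhs : Gamma O →+ (sheafOfModule ρ).stalk z :=
    AddMonoidHom.mk' (fun f => ∑ᶠ y, (sheafOfModule ρ).block f y z (stalkGerm ρ y m))
      fun f g => by
        simp only [SheafOfModules.block_add, AddMonoidHom.add_apply]
        exact finsum_add_distrib ((sheafOfModule ρ).finite_support_block_apply f z _)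
          ((sheafOfModule ρ).finite_support_block_apply g z _)
  have h : lhs = rhs := gamma_hom_ext fun f U hU hf => stalkGerm_rep_of_supportedOn hU hf z m
  exact DFunLike.congr_fun h f

theorem exists_compactOpens_inter_finite {F : Set X} (hF : F.Finite) (x : X) :
    ∃ V : CompactOpens X, x ∈ V ∧ ∀ y ∈ F, y ∈ V → y = x := by
  obtain ⟨V, hxV, hV⟩ :=
    exists_compactOpens (hF.sdiff (t := {x})).isClosed.isOpen_compl (fun h => h.2 rfl)
  exact ⟨V, hxV, fun y hy hyV => by_contra fun hyx => hV hyV ⟨hy, hyx⟩⟩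

theorem exists_stalkGerm_rep_eq_block (f : Gamma O) (y z : X) (m : S) :
    ∃ n, stalkGerm ρ z (ρ f n) = (sheafOfModule ρ).block f y z (stalkGerm ρ y m) := by
  obtain ⟨V, hyV, hV⟩ :=
    exists_compactOpens_inter_finite ((sheafOfModule ρ).finite_block_ne_zero f z) y
  refine ⟨ρ (chi O V) m, ?_⟩
  rw [stalkGerm_rep, finsum_eq_single _ y, stalkGerm_rep_chi_of_mem hyV]
  intro y' hy'
  by_cases hblock : (sheafOfModule ρ).block f y' z = 0
  · rw [hblock, AddMonoidHom.zero_apply]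
  · rw [stalkGerm_rep_chi_of_notMem fun hyV' => hy' (hV y' hblock hyV'), map_zero]

variable (ρ) in
/-- The submodule of those `m ∈ S` whose germs vanish along the orbit of `x`. -/
def orbitNullGerms (x : X) : AddSubgroup S := ⨅ y : orbit x, (stalkGerm ρ y).ker

theorem mem_orbitNullGerms {x : X} {m : S} :
    m ∈ orbitNullGerms ρ x ↔ ∀ y : orbit x, stalkGerm ρ y m = 0 := by
  simp only [orbitNullGerms, AddSubgroup.mem_iInf, AddMonoidHom.mem_ker]

theorem rep_mem_orbitNullGerms {x : X} (f : Gamma O) {m : S} (hm : m ∈ orbitNullGerms ρ x) :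
    ρ f m ∈ orbitNullGerms ρ x := by
  refine mem_orbitNullGerms.2 fun z => ?_
  rw [stalkGerm_rep]
  refine finsum_eq_zero_of_forall_eq_zero fun y => ?_
  by_cases hy : y ∈ orbit x
  · rw [mem_orbitNullGerms.1 hm ⟨y, hy⟩, map_zero]
  · rw [(sheafOfModule ρ).block_eq_zero_of_notMem_orbit f hy z.2, AddMonoidHom.zero_apply]

theorem forall_rep_mem_orbitNullGerms_iff {x : X} {f : Gamma O} :
    (∀ m, ρ f m ∈ orbitNullGerms ρ x) ↔
      ∀ y z : orbit x, (sheafOfModule ρ).block f y z = 0 := by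
  constructor
  · intro hf y z
    ext s
    obtain ⟨m, rfl⟩ := stalkGerm_surjective s
    obtain ⟨n, hn⟩ := exists_stalkGerm_rep_eq_block f y.1 z.1 m
    rw [← hn, mem_orbitNullGerms.1 (hf n) z, AddMonoidHom.zero_apply]
  · refine fun hf m => mem_orbitNullGerms.2 fun z => ?_
    rw [stalkGerm_rep]
    refine finsum_eq_zero_of_forall_eq_zero fun y => ?_
    by_cases hy : y ∈ orbit x
    · rw [hf ⟨y, hy⟩ z, AddMonoidHom.zero_apply]
    · rw [(sheafOfModule ρ).block_eq_zero_of_notMem_orbit f hy z.2, AddMonoidHom.zero_apply]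

theorem mem_annihilator_ind_stalk_iff {x : X} {f : Gamma O} :
    f ∈ annihilator (ind O x ((sheafOfModule ρ).stalk x)) ↔ ∀ m, ρ f m ∈ orbitNullGerms ρ x := by
  rw [mem_annihilator_ind_iff_block, forall_rep_mem_orbitNullGerms_iff]

end Germs

section LocalUnits

theorem eventually_chi_mul_eq_self (f : Gamma O) :
    ∀ᶠ V : CompactOpens X in Filter.atTop, chi O V * f = f := by
  refine eventually_apply_eq_self_of_closure_eq_top
    (e := fun V : CompactOpens X => AddMonoidHom.mulLeft (chi O V)) closure_gamma_generators ?_ f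
  rintro f ⟨U, hU, hf⟩
  let rangeU : CompactOpens X :=
    ⟨⟨Arr.tgt '' U, hU.isCompact.image AmpleGroupoid.continuous_tgt⟩, isOpenMap_tgt _ hU.isOpen⟩
  filter_upwards [Filter.eventually_ge_atTop rangeU] with V hV
  refine gamma_ext fun γ => (chi_mul_apply V f γ).trans ?_
  split_ifs with hγ
  · rfl
  · exact (hf.2 γ fun hγU => hγ (hV ⟨γ, hγU, rfl⟩)).symm

variable {S : Type z} [AddCommGroup S] {ρ : Gamma O →ₙ+* AddMonoid.End S}

theorem eventually_rep_chi_eq_self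
    (hρ : AddSubgroup.closure {s : S | ∃ (f : Gamma O) (m : S), s = ρ f m} = ⊤) (m : S) :
    ∀ᶠ V : CompactOpens X in Filter.atTop, ρ (chi O V) m = m := by
  refine eventually_apply_eq_self_of_closure_eq_top
    (e := fun V : CompactOpens X => ρ (chi O V)) hρ ?_ m
  rintro _ ⟨f, m, rfl⟩
  filter_upwards [eventually_chi_mul_eq_self f] with V hV
  exact (rep_mul ρ (chi O V) f m).symm.trans (by rw [hV])

theorem rep_chi_eq_zero_of_le {V W : CompactOpens X} (h : V ≤ W) {m : S}
    (hm : ρ (chi O W) m = 0) : ρ (chi O V) m = 0 := by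
  rw [← inf_eq_left.2 h, ← chi_mul_chi, rep_mul, hm, map_zero]

theorem chi_bot : chi O (⊥ : CompactOpens X) = 0 :=
  gamma_ext fun _ => if_neg fun ⟨_, hx, _⟩ => hx

theorem chi_sup (V W : CompactOpens X) :
    chi O (V ⊔ W) = chi O V + chi O W - chi O V * chi O W := by
  rw [chi_mul_chi]
  refine gamma_ext fun γ => ?_
  have hunit : Function.Injective (unit : X → Arr X) := fun x y h => congrArg Arr.tgt h
  have hsup : γ ∈ unit '' ((V ⊔ W : CompactOpens X) : Set X) ↔
      γ ∈ unit '' (V : Set X) ∨ γ ∈ unit '' (W : Set X) := by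
    rw [CompactOpens.coe_sup, Set.image_union, Set.mem_union]
  have hinf : γ ∈ unit '' ((V ⊓ W : CompactOpens X) : Set X) ↔
      γ ∈ unit '' (V : Set X) ∧ γ ∈ unit '' (W : Set X) := by
    rw [CompactOpens.coe_inf, Set.image_inter hunit, Set.mem_inter_iff]
  change chiFun O _ γ = chiFun O _ γ + chiFun O _ γ - chiFun O _ γ
  simp only [chiFun, hsup, hinf]
  split_ifs <;> simp_all

theorem rep_chi_sup_eq_zero {V W : CompactOpens X} {m : S} (hV : ρ (chi O V) m = 0)
    (hW : ρ (chi O W) m = 0) : ρ (chi O (V ⊔ W)) m = 0 := by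
  rw [chi_sup, map_sub, map_add, map_mul]
  change ρ (chi O V) m + ρ (chi O W) m - ρ (chi O V) (ρ (chi O W) m) = 0
  rw [hV, hW, map_zero, add_zero, sub_zero]

theorem rep_chi_eq_zero_of_forall_stalkGerm_eq_zero {V : CompactOpens X} {m : S}
    (hm : ∀ x ∈ V, stalkGerm ρ x m = 0) : ρ (chi O V) m = 0 := by
  suffices h : ∃ W : CompactOpens X, (V : Set X) ⊆ W ∧ ρ (chi O W) m = 0 by
    obtain ⟨W, hVW, hW⟩ := h
    exact rep_chi_eq_zero_of_le hVW hW
  refine V.isCompact.induction_on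
    (p := fun K : Set X => ∃ W : CompactOpens X, K ⊆ W ∧ ρ (chi O W) m = 0) ?_ ?_ ?_ ?_
  · exact ⟨⊥, Set.empty_subset _, by rw [chi_bot, map_zero, AddMonoid.End.zero_apply]⟩
  · rintro K L hKL ⟨W, hLW, hW⟩
    exact ⟨W, hKL.trans hLW, hW⟩
  · rintro K L ⟨W, hKW, hW⟩ ⟨W', hLW', hW'⟩
    exact ⟨W ⊔ W', Set.union_subset_union hKW hLW', rep_chi_sup_eq_zero hW hW'⟩
  · intro x hx
    obtain ⟨W, hxW, hW⟩ := stalkGerm_eq_zero.1 (hm x hx)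
    exact ⟨W, mem_nhdsWithin_of_mem_nhds (W.isOpen.mem_nhds hxW), W, subset_rfl, hW⟩

theorem eq_zero_of_forall_stalkGerm_eq_zero
    (hρ : AddSubgroup.closure {s : S | ∃ (f : Gamma O) (m : S), s = ρ f m} = ⊤) {m : S}
    (hm : ∀ x, stalkGerm ρ x m = 0) : m = 0 := by
  obtain ⟨V, hV⟩ := (eventually_rep_chi_eq_self hρ m).exists
  rw [← hV]
  exact rep_chi_eq_zero_of_forall_stalkGerm_eq_zero fun x _ => hm x

end LocalUnits

section SimpleModules

variable {S : Type z} [AddCommGroup S] {ρ : Gamma O →ₙ+* AddMonoid.End S}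

theorem IsSimpleRep.exists_nontrivial_stalk (hρ : IsSimpleRep ρ) :
    ∃ x : X, Nontrivial ((sheafOfModule ρ).stalk x) := by
  by_contra! hsub
  have := hρ.nontrivial
  obtain ⟨m, hm⟩ := exists_ne (0 : S)
  exact hm <| eq_zero_of_forall_stalkGerm_eq_zero hρ.unitary fun x =>
    have := hsub x
    Subsingleton.elim _ _

theorem IsSimpleRep.orbitNullGerms_eq_bot (hρ : IsSimpleRep ρ) {x : X}
    (hx : Nontrivial ((sheafOfModule ρ).stalk x)) : orbitNullGerms ρ x = ⊥ := by
  refine (hρ.eq_bot_or_eq_top _ fun f m => rep_mem_orbitNullGerms f).resolve_right fun htop => ?_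
  obtain ⟨s, hs⟩ := exists_ne (0 : (sheafOfModule ρ).stalk x)
  obtain ⟨m, rfl⟩ := stalkGerm_surjective s
  have hm : m ∈ orbitNullGerms ρ x := htop ▸ AddSubgroup.mem_top m
  exact hs (mem_orbitNullGerms.1 hm ⟨x, ⟨𝟙 x⟩⟩)

theorem IsSimpleRep.annihilator_eq_annihilator_ind (hρ : IsSimpleRep ρ) {x : X}
    (hx : Nontrivial ((sheafOfModule ρ).stalk x)) :
    annihilator ρ = annihilator (ind O x ((sheafOfModule ρ).stalk x)) := by
  ext f
  rw [mem_annihilator_ind_stalk_iff, hρ.orbitNullGerms_eq_bot hx, annihilator,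
    TwoSidedIdeal.mem_ker]
  simp only [AddSubgroup.mem_bot]
  exact DFunLike.ext_iff

end SimpleModules

end AmpleSheaf

end

theorem mainTheorem3 {X : Type u} [TopologicalSpace X] [Groupoid.{v} X] [AmpleGroupoid X]
    (O : SheafOfRings.{u, v, w} X) (I : TwoSidedIdeal (Gamma O)) (hI : IsPrimitiveIdeal.{z} I) :
    (∃ (x : X) (M : Type z) (_ : AddCommGroup M) (_ : Module (IsotropyRing O x) M),
      I = annihilator (ind O x M)) ∧
    ∀ (S : Type z) [AddCommGroup S] (ρ : Gamma O →ₙ+* AddMonoid.End S),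
      IsSimpleRep ρ → I = annihilator ρ →
        (∃ x : X, Nontrivial ((sheafOfModule ρ).stalk x)) ∧
        ∀ x : X, Nontrivial ((sheafOfModule ρ).stalk x) →
          I = annihilator (ind O x ((sheafOfModule ρ).stalk x)) := by
  refine ⟨?_, fun S _ ρ hρ hI => ⟨hρ.exists_nontrivial_stalk, fun x hx =>
    hI.trans (hρ.annihilator_eq_annihilator_ind hx)⟩⟩
  obtain ⟨S, _, ρ, hρ, rfl⟩ := hI
  obtain ⟨x, hx⟩ := hρ.exists_nontrivial_stalk
  exact ⟨x, (sheafOfModule ρ).stalk x, inferInstance, inferInstance,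
    hρ.annihilator_eq_annihilator_ind hx⟩
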